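/- **Setting.** Let $X$ be a smooth projective geometrically irreducible curve over a finite field $\mathbb F$ with $q$ elements, $\infty$ a closed point of $X$, $A=H^0(X\setminus\{\infty\},\mathcal O_X)$, $K=\operatorname{Frac}(A)$, and $\mathbb C_\infty$ the completion, at a place above $\infty$, of an algebraic closure of $K$. Let $K\subseteq L\subseteq\mathbb C_\infty$ be an intermediate field, with inclusion $\ell:K\to L$, and let $\tau$ be the $q$-power Frobenius. Unlabelled tensor products are over $\mathbb F$. Let $(E,\phi)$ be an Anderson $A$-module of dimension $d\ge 1$ over $L$: $E$ is an $\mathbb F$-vector space scheme over $L$ isomorphic to $\mathbb G_{a,L}^d$, and $\phi:A\to\operatorname{End}_{\mathbb F,L}(E)$ is a homomorphism of $\mathbb F$-algebras such that $\partial\phi_a-\ell(a)$ is nilpotent on $\operatorname{Lie}_E$ for all $a\in A$. Choosing coordinates $E\cong\mathbb G_{a,L}^d$, this is a homomorphism of $\mathbb F$-algebras $\phi:A\to \operatorname{Mat}_{d}(L)\{\tau\}$, $\phi_a=\sum_n\phi_{a,n}\tau^n$ (where $\tau M=M^{(1)}\tau$, with $M^{(1)}$ the entrywise $q$-th power of $M$),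 with $\partial a:=\partial\phi_a=\phi_{a,0}$ and $\phi_{a,0}-\ell(a)$ nilpotent for all $a$. Then $E(\mathbb C_\infty)=\mathbb C_\infty^d$ is an $A$-module through $\phi$, and $\operatorname{Lie}_E(\mathbb C_\infty)=\mathbb C_\infty^d$ is an $A$-module through $\partial\phi$; for $r=a/b\in K$ put $\partial r=(\partial b)^{-1}\partial a$. Let $\exp_E:\operatorname{Lie}_E(\mathbb C_\infty)\to E(\mathbb C_\infty)$ be the exponential of $E$, i.e. the unique $A$-linear map given by an everywhere convergent series $\exp_E(x)=x+\sum_{n\ge1}e_n\tau^n(x)$ with $d\times d$ matrices $e_n$ over $\mathbb C_\infty$, and $\Lambda_E=\ker(\exp_E)$ the period lattice. For an $\mathbb F$-algebra $B$ of countable dimension and a normed $\mathbb F$-vector space $V$, let $B\hat\otimes V$ be the completion of $B\otimes V$ for the norm $\|x\|=\inf\max_i|v_i|$, the infimum being over all representations $x=\sum_i b_i\otimes v_i$. With the maximum norm on $\mathbb C_\infty^d$ put $E(\mathbb T)=A\hat\otimes E(\mathbb C_\infty)$ and $\operatorname{Lie}_E(\mathbb T)=A\hat\otimes\operatorname{Lie}_E(\mathbb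 C_\infty)$; both carry two $A$-actions, through $a\otimes1$ and through $1\otimes a$ (acting by $\phi_a$, respectively $\partial a$, on the second factor). The $A$-module of special functions is $$\mathfrak{sf}(E)=\{\omega\in E(\mathbb T)\mid (a\otimes 1)\omega=(1\otimes a)\omega\ \text{ for all } a\in A\}.$$ Let $\mathfrak p$ be a maximal ideal of $A$ with residue field $\mathbb F_{\mathfrak p}=A/\mathfrak p$, and let $u=u_{\mathfrak p}\in\mathfrak p\setminus\mathfrak p^2$ be a uniformizer. Let $\mathfrak d_{A/\mathbb F[u]}\subseteq A$ be the different ideal of $A$ over $\mathbb F[u]$. The map $\delta_u:\mathfrak d_{A/\mathbb F[u]}\cdot\Lambda_E\to\mathfrak{sf}(E)$ is defined as follows: for $\mu\in\mathfrak d_{A/\mathbb F[u]}\cdot\Lambda_E$ there is a unique $x\in A\otimes_{\mathbb F[u]}\Lambda_E$ with $(a\otimes1)x=(1\otimes a)x$ for all $a\in A$ whose image under the multiplication map $A\otimes_{\mathbb F[u]}\Lambda_E\to\Lambda_E$ is $\mu$, and $$\delta_u(\mu)=(\operatorname{id}\hat\otimes\exp_E)\bigl((1\otimes\partial u-u\otimes1)^{-1}x\bigr),$$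 computed in $\operatorname{Lie}_E(\mathbb T)$ with any representative of $x$ in $A\otimes\Lambda_E$. Let $\chi=\chi_{\mathfrak P}:(A/\mathfrak p)^\times\to\mathbb F_{\mathfrak p}^\times$ be an evaluative multiplicative character, i.e. a group homomorphism whose extension by zero to a map $\chi:A\to\mathbb F_{\mathfrak p}$ (with $\chi(a)=\chi(a+\mathfrak p)$ for $a\notin\mathfrak p$ and $\chi(a)=0$ for $a\in\mathfrak p$) is a homomorphism of $\mathbb F$-algebras. Let $$G(E,\chi)=\{g\in\mathbb F_{\mathfrak p}\otimes E(\mathbb C_\infty)\mid(1\otimes a)g=(\chi(a)\otimes1)g\ \text{ for all }a\in A\},$$ an $A$-module through $1\otimes a$. For an $A$-linear map $\psi:A/\mathfrak p\to E(\mathbb C_\infty)$ let $$g(\chi,\psi)=-\sum_{x\in(A/\mathfrak p)^\times}\chi(x)^{-1}\otimes\psi(x)$$ be the Gauss–Thakur sum. Let $z\in\mathfrak p^{-1}$ satisfy $uz\equiv1\bmod\mathfrak p$, and for $\lambda\in\Lambda_E$ let $\psi_\lambda:A/\mathfrak p\to E(\mathbb C_\infty)$ be the $A$-linear map $a\mapsto\exp_E(\partial(az)\lambda)$.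 **Theorem.** The maps $\delta_u:\mathfrak d_{A/\mathbb F[u]}\cdot\Lambda_E\to\mathfrak{sf}(E)$, $\ \lambda\mapsto\psi_\lambda$, $\ g_u:\Lambda_E\to G(E,\chi)$, $\lambda\mapsto g(\chi,\psi_\lambda)$, and the evaluation $\chi\hat\otimes\operatorname{id}:\mathfrak{sf}(E)\to G(E,\chi)$, $\omega\mapsto\omega(\mathfrak P)$, are well-defined homomorphisms of $A$-modules, and $$(\chi\,\hat\otimes\operatorname{id})\circ\delta_u=g_u\qquad\text{on }\ \mathfrak d_{A/\mathbb F[u]}\cdot\Lambda_E .$$ That is, $\delta_u(\mu)(\mathfrak P)=g(\chi_{\mathfrak P},\psi_\mu)$ for every $\mu\in\mathfrak d_{A/\mathbb F[u]}\cdot\Lambda_E$. -/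

import Mathlib

open scoped TensorProduct nonZeroDivisors

set_option linter.unusedSectionVars false
set_option linter.unusedSimpArgs false

namespace AndersonModule

section Twist

variable (F : Type*) {C : Type*} [Field F] [Fintype F] [NormedField C] [Algebra F C]
  {d : ℕ}

/-- The `n`-fold `q`-power Frobenius on vectors, applied coordinatewise; `q = #F`. -/
def tau (n : ℕ) (x : Fin d → C) : Fin d → C := fun i => x i ^ Fintype.card F ^ n

/-- The `n`-fold Frobenius twist of a matrix (entrywise `q ^ n`-th powers). -/
def twist (n : ℕ) (M : Matrix (Fin d) (Fin d) C) : Matrix (Fin d) (Fin d) C :=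
  M.map fun c => c ^ Fintype.card F ^ n

/-- The value of the twisted polynomial `∑ M_n τ ^ n` at the vector `x`. -/
noncomputable def twistedEval (M : ℕ →₀ Matrix (Fin d) (Fin d) C) (x : Fin d → C) : Fin d → C :=
  M.sum fun n B => B.mulVec (tau F n x)

lemma frob_pow_apply (n : ℕ) (c : C) :
    ((FiniteField.frobeniusAlgHom F C) ^ n) c = c ^ Fintype.card F ^ n := by
  rw [AlgHom.coe_pow, FiniteField.coe_frobeniusAlgHom, pow_iterate]

lemma add_pow_card_pow (n : ℕ) (x y : C) :
    (x + y) ^ Fintype.card F ^ n = x ^ Fintype.card F ^ n + y ^ Fintype.card F ^ n := by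
  simp only [← frob_pow_apply F n, map_add]

lemma sum_pow_card_pow {ι : Type*} (s : Finset ι) (n : ℕ) (f : ι → C) :
    (∑ i ∈ s, f i) ^ Fintype.card F ^ n = ∑ i ∈ s, f i ^ Fintype.card F ^ n := by
  simp only [← frob_pow_apply F n, map_sum]

lemma algebraMap_pow_card_pow (n : ℕ) (c : F) :
    (algebraMap F C c) ^ Fintype.card F ^ n = algebraMap F C c := by
  rw [← frob_pow_apply F n, AlgHom.commutes]

lemma card_pow_ne_zero (n : ℕ) : Fintype.card F ^ n ≠ 0 := pow_ne_zero _ Fintype.card_ne_zero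

lemma tau_add (n : ℕ) (x y : Fin d → C) : tau F n (x + y) = tau F n x + tau F n y := by
  ext i; simp [tau, add_pow_card_pow]

@[simp] lemma tau_zero (n : ℕ) : tau F n (0 : Fin d → C) = 0 := by
  ext i; simp [tau, card_pow_ne_zero]

@[simp] lemma tau_zero_left (x : Fin d → C) : tau F 0 x = x := by
  ext i; simp [tau]

@[simp] lemma twist_zero_left (M : Matrix (Fin d) (Fin d) C) : twist F 0 M = M := by
  ext i j; simp [twist]

@[simp] lemma twist_one (n : ℕ) : twist F n (1 : Matrix (Fin d) (Fin d) C) = 1 := by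
  ext i j; simp [twist, Matrix.one_apply, apply_ite (· ^ Fintype.card F ^ n), card_pow_ne_zero]

lemma tau_smul (n : ℕ) (c : C) (x : Fin d → C) :
    tau F n (c • x) = c ^ Fintype.card F ^ n • tau F n x := by
  ext i; simp [tau, mul_pow]

lemma tau_tau (m n : ℕ) (x : Fin d → C) : tau F m (tau F n x) = tau F (m + n) x := by
  ext i; simp [tau, ← pow_mul, ← pow_add, add_comm]

lemma tau_sum {ι : Type*} (s : Finset ι) (n : ℕ) (f : ι → Fin d → C) :
    tau F n (∑ i ∈ s, f i) = ∑ i ∈ s, tau F n (f i) := by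
  ext i; simp [tau, sum_pow_card_pow]

lemma tau_mulVec (n : ℕ) (M : Matrix (Fin d) (Fin d) C) (x : Fin d → C) :
    tau F n (M.mulVec x) = (twist F n M).mulVec (tau F n x) := by
  ext i; simp [tau, twist, Matrix.mulVec, dotProduct, sum_pow_card_pow, mul_pow]

lemma twistedEval_eq_sum {M : ℕ →₀ Matrix (Fin d) (Fin d) C} {s : Finset ℕ}
    (hs : M.support ⊆ s) (x : Fin d → C) :
    twistedEval F M x = ∑ n ∈ s, (M n).mulVec (tau F n x) :=
  Finsupp.sum_of_support_subset _ hs _ (by simp)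

lemma twistedEval_add (M : ℕ →₀ Matrix (Fin d) (Fin d) C) (x y : Fin d → C) :
    twistedEval F M (x + y) = twistedEval F M x + twistedEval F M y := by
  simp [twistedEval, Finsupp.sum, tau_add, Matrix.mulVec_add, Finset.sum_add_distrib]

lemma twistedEval_zero (M : ℕ →₀ Matrix (Fin d) (Fin d) C) :
    twistedEval F M (0 : Fin d → C) = 0 := by
  simp [twistedEval, Finsupp.sum]

lemma twistedEval_add_left (M N : ℕ →₀ Matrix (Fin d) (Fin d) C) (x : Fin d → C) :
    twistedEval F (M + N) x = twistedEval F M x + twistedEval F N x := by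
  classical
  exact Finsupp.sum_add_index' (by simp) (by simp [Matrix.add_mulVec])

lemma twistedEval_mul {M N P : ℕ →₀ Matrix (Fin d) (Fin d) C}
    (h : ∀ n, P n = ∑ p ∈ Finset.HasAntidiagonal.antidiagonal n, M p.1 * twist F p.1 (N p.2)) (x : Fin d → C) :
    twistedEval F P x = twistedEval F M (twistedEval F N x) := by
  classical
  let g : ℕ × ℕ → Fin d → C := fun p => (M p.1 * twist F p.1 (N p.2)).mulVec (tau F (p.1 + p.2) x)
  have hg : ∀ p, p ∉ M.support ×ˢ N.support → g p = 0 := by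
    intro p hp
    simp only [Finset.mem_product, Finsupp.mem_support_iff, not_and_or, not_not] at hp
    rcases hp with hp | hp <;> simp only [g, hp]
    · simp
    · have : twist F p.1 (0 : Matrix (Fin d) (Fin d) C) = 0 := by
        ext i j; simp [twist, card_pow_ne_zero]
      simp [this]
  have hR : twistedEval F M (twistedEval F N x) = ∑ p ∈ M.support ×ˢ N.support, g p := by
    simp only [twistedEval, Finsupp.sum, Finset.sum_product, tau_sum, tau_mulVec, tau_tau, g,
      Matrix.mulVec_sum, Matrix.mulVec_mulVec]
  let T := P.support ∪ (M.support ×ˢ N.support).image (fun p => p.1 + p.2)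
  rw [hR, twistedEval_eq_sum F (s := T) Finset.subset_union_left,
    ← Finset.sum_fiberwise_of_maps_to (s := M.support ×ˢ N.support) (t := T)
      (g := fun p => p.1 + p.2)
      (fun p hp => Finset.mem_union_right _ (Finset.mem_image_of_mem _ hp))]
  refine Finset.sum_congr rfl fun n _ => ?_
  rw [h n, Matrix.sum_mulVec]
  have h1 : ∀ p ∈ Finset.HasAntidiagonal.antidiagonal n,
      (M p.1 * twist F p.1 (N p.2)).mulVec (tau F n x) = g p := by
    intro p hp
    rw [Finset.HasAntidiagonal.mem_antidiagonal] at hp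
    simp only [g, hp]
  rw [Finset.sum_congr rfl h1]
  symm
  refine Finset.sum_subset ?_ ?_
  · intro p hp
    simpa using (Finset.mem_filter.1 hp).2
  · intro p hp hp'
    apply hg
    intro hp2
    exact hp' (Finset.mem_filter.2 ⟨hp2, by simpa using hp⟩)

lemma continuous_twistedEval (M : ℕ →₀ Matrix (Fin d) (Fin d) C) :
    Continuous (twistedEval F M : (Fin d → C) → Fin d → C) := by
  unfold twistedEval Finsupp.sum Matrix.mulVec dotProduct tau
  fun_prop

end Twist

section Convergence

variable (F : Type*) {C : Type*} [Field F] [Fintype F] [NormedField C] [Algebra F C]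
  [IsUltrametricDist C] {d : ℕ}

/-- The maximum of the absolute values of the entries of a matrix. -/
noncomputable def entryNorm (M : Matrix (Fin d) (Fin d) C) : ℝ :=
  ‖fun p : Fin d × Fin d => M p.1 p.2‖

lemma entryNorm_nonneg (M : Matrix (Fin d) (Fin d) C) : 0 ≤ entryNorm M :=
  norm_nonneg fun p : Fin d × Fin d => M p.1 p.2

lemma norm_entry_le (M : Matrix (Fin d) (Fin d) C) (i j : Fin d) : ‖M i j‖ ≤ entryNorm M :=
  norm_le_pi_norm (fun p : Fin d × Fin d => M p.1 p.2) (i, j)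

lemma entryNorm_le {M : Matrix (Fin d) (Fin d) C} {r : ℝ} (hr : 0 ≤ r)
    (h : ∀ i j, ‖M i j‖ ≤ r) : entryNorm M ≤ r :=
  (pi_norm_le_iff_of_nonneg hr).2 fun p => h p.1 p.2

lemma entryNorm_mul_le (M N : Matrix (Fin d) (Fin d) C) :
    entryNorm (M * N) ≤ entryNorm M * entryNorm N := by
  refine entryNorm_le (mul_nonneg (norm_nonneg _) (norm_nonneg _)) fun i j => ?_
  rw [Matrix.mul_apply]
  refine IsUltrametricDist.norm_sum_le_of_forall_le_of_nonneg
    (mul_nonneg (norm_nonneg _) (norm_nonneg _)) fun k _ => ?_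
  rw [norm_mul]
  exact mul_le_mul (norm_entry_le M i k) (norm_entry_le N k j) (norm_nonneg _) (norm_nonneg _)

lemma norm_mulVec_le (M : Matrix (Fin d) (Fin d) C) (x : Fin d → C) :
    ‖M.mulVec x‖ ≤ entryNorm M * ‖x‖ := by
  have h0 : 0 ≤ entryNorm M * ‖x‖ := mul_nonneg (entryNorm_nonneg M) (norm_nonneg x)
  refine (pi_norm_le_iff_of_nonneg h0).2 fun i => ?_
  have h : M.mulVec x i = ∑ k, M i k * x k := rfl
  rw [h]
  refine IsUltrametricDist.norm_sum_le_of_forall_le_of_nonneg h0 fun k _ => ?_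
  rw [norm_mul]
  exact mul_le_mul (norm_entry_le M i k) (norm_le_pi_norm x k) (norm_nonneg _) (entryNorm_nonneg M)

lemma entryNorm_twist_le (n : ℕ) (M : Matrix (Fin d) (Fin d) C) :
    entryNorm (twist F n M) ≤ entryNorm M ^ Fintype.card F ^ n := by
  refine entryNorm_le (pow_nonneg (norm_nonneg _) _) fun i j => ?_
  simp only [twist, Matrix.map_apply, norm_pow]
  exact pow_le_pow_left₀ (norm_nonneg _) (norm_entry_le M i j) _

lemma norm_tau_le (n : ℕ) (x : Fin d → C) : ‖tau F n x‖ ≤ ‖x‖ ^ Fintype.card F ^ n := by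
  refine (pi_norm_le_iff_of_nonneg (pow_nonneg (norm_nonneg _) _)).2 fun i => ?_
  simp only [tau, norm_pow]
  exact pow_le_pow_left₀ (norm_nonneg _) (norm_le_pi_norm x i) _

lemma lt_card_pow (n : ℕ) : n < Fintype.card F ^ n := Nat.lt_pow_self Fintype.one_lt_card

lemma two_le_card_pow {n : ℕ} (hn : n ≠ 0) : 2 ≤ Fintype.card F ^ n :=
  (Fintype.one_lt_card (α := F)).trans_le (Nat.le_self_pow hn _)

/-- A twisted polynomial is its linear part up to a quadratic error near `0`. -/
lemma exists_twistedEval_bound (M : ℕ →₀ Matrix (Fin d) (Fin d) C) :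
    ∃ β : ℝ, 0 ≤ β ∧ ∀ x : Fin d → C, ‖x‖ ≤ 1 →
      ‖twistedEval F M x - (M 0).mulVec x‖ ≤ β * ‖x‖ ^ 2 := by
  classical
  let s : Finset ℕ := insert 0 M.support
  refine ⟨∑ n ∈ s, entryNorm (M n), Finset.sum_nonneg fun n _ => norm_nonneg _, fun x hx => ?_⟩
  have h0 : 0 ∈ s := Finset.mem_insert_self _ _
  rw [twistedEval_eq_sum F (s := s) (Finset.subset_insert _ _), ← Finset.add_sum_erase s _ h0,
    tau_zero_left, add_sub_cancel_left]
  have hβ : 0 ≤ ∑ n ∈ s, entryNorm (M n) := Finset.sum_nonneg fun n _ => norm_nonneg _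
  refine IsUltrametricDist.norm_sum_le_of_forall_le_of_nonneg
    (mul_nonneg hβ (sq_nonneg _)) fun n hn => ?_
  rw [Finset.mem_erase] at hn
  refine (norm_mulVec_le _ _).trans ?_
  refine mul_le_mul (Finset.single_le_sum (f := fun n => entryNorm (M n))
    (fun n _ => norm_nonneg _) hn.2) ?_ (norm_nonneg _) hβ
  exact (norm_tau_le F n x).trans
    (pow_le_pow_of_le_one (norm_nonneg _) hx (two_le_card_pow F hn.1))

/-- The coefficients of the exponential, computed from one twisted polynomial `θ + ∑ B_i τ ^ i`
with scalar linear part. -/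
noncomputable def expCoeff (θ : C) (B : ℕ → Matrix (Fin d) (Fin d) C) :
    ℕ → Matrix (Fin d) (Fin d) C
  | 0 => 1
  | n + 1 => (θ ^ Fintype.card F ^ (n + 1) - θ)⁻¹ •
      ∑ j : Fin (n + 1), B (n + 1 - j) * twist F (n + 1 - j) (expCoeff θ B j)
decreasing_by exact j.2

lemma norm_pow_sub_self {θ : C} (hθ : 1 < ‖θ‖) {n : ℕ} (hn : n ≠ 0) :
    ‖θ ^ Fintype.card F ^ n - θ‖ = ‖θ‖ ^ Fintype.card F ^ n := by
  have h : ‖θ‖ < ‖θ ^ Fintype.card F ^ n‖ := by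
    rw [norm_pow]
    exact lt_self_pow₀ hθ (two_le_card_pow F hn)
  rw [sub_eq_add_neg, IsUltrametricDist.norm_add_eq_max_of_norm_ne_norm (by rw [norm_neg]; exact h.ne'),
    norm_neg, max_eq_left h.le, norm_pow]

lemma expCoeff_smul {θ : C} (hθ : 1 < ‖θ‖) (B : ℕ → Matrix (Fin d) (Fin d) C)
    (hB : B 0 = θ • 1) (n : ℕ) :
    θ ^ Fintype.card F ^ n • expCoeff F θ B n =
      ∑ j ∈ Finset.range (n + 1), B (n - j) * twist F (n - j) (expCoeff F θ B j) := by
  rw [Finset.sum_range_succ, Nat.sub_self, hB, twist_zero_left, smul_mul_assoc, one_mul]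
  rcases n with _ | n
  · simp
  · have hne : θ ^ Fintype.card F ^ (n + 1) - θ ≠ 0 := by
      rw [← norm_ne_zero_iff, norm_pow_sub_self F hθ (Nat.succ_ne_zero n)]
      positivity
    rw [← sub_eq_iff_eq_add, ← sub_smul, expCoeff, smul_inv_smul₀ hne,
      Finset.sum_range fun j => B (n + 1 - j) * twist F (n + 1 - j) (expCoeff F θ B j)]

lemma exists_expCoeff_bound {θ : C} (hθ : 1 < ‖θ‖) (B : ℕ → Matrix (Fin d) (Fin d) C)
    (r : ℕ) (hr : ∀ i, r < i → B i = 0) :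
    ∃ c ρ : ℝ, 1 ≤ c ∧ 1 < ρ ∧
      ∀ n, entryNorm (expCoeff F θ B n) ≤ (c / ρ ^ n) ^ Fintype.card F ^ n := by
  set q := Fintype.card F with hq
  obtain ⟨ρ, hρ1, hρ⟩ : ∃ ρ : ℝ, 1 < ρ ∧ ρ ^ (2 * (r + 1)) = ‖θ‖ := by
    refine ⟨‖θ‖ ^ (((2 * (r + 1) : ℕ) : ℝ)⁻¹), Real.one_lt_rpow hθ (by positivity), ?_⟩
    exact Real.rpow_inv_natCast_pow (norm_nonneg _) (by positivity)
  have hρ0 : 0 < ρ := zero_lt_one.trans hρ1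
  let β : ℝ := ∑ i ∈ Finset.range (r + 1), entryNorm (B i)
  have hβ : ∀ i, entryNorm (B i) ≤ β := by
    intro i
    by_cases hi : r < i
    · rw [hr i hi]
      have h0 : entryNorm (0 : Matrix (Fin d) (Fin d) C) ≤ 0 := entryNorm_le le_rfl (by simp)
      exact h0.trans (Finset.sum_nonneg fun n _ => norm_nonneg _)
    · exact Finset.single_le_sum (f := fun n => entryNorm (B n)) (fun n _ => norm_nonneg _)
        (by simp; omega)
  have hβ0 : 0 ≤ β := (norm_nonneg _).trans (hβ 0)
  obtain ⟨N, hN⟩ : ∃ N : ℕ, β ≤ ρ ^ N := by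
    obtain ⟨N, hN⟩ := pow_unbounded_of_one_lt β hρ1
    exact ⟨N, hN.le⟩
  let c : ℝ := 1 + ∑ m ∈ Finset.range (N + 1), entryNorm (expCoeff F θ B m) * (ρ ^ m) ^ q ^ m
  have hterm : ∀ m, 0 ≤ entryNorm (expCoeff F θ B m) * (ρ ^ m) ^ q ^ m := fun m =>
    mul_nonneg (norm_nonneg _) (by positivity)
  have hc1 : 1 ≤ c := le_add_of_nonneg_right (Finset.sum_nonneg fun m _ => hterm m)
  have hc0 : 0 < c := zero_lt_one.trans_le hc1
  refine ⟨c, ρ, hc1, hρ1, fun n => ?_⟩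
  induction n using Nat.strong_induction_on with
  | _ n ih =>
  by_cases hn : n < N + 1
  · rw [div_pow, le_div_iff₀ (by positivity)]
    calc entryNorm (expCoeff F θ B n) * (ρ ^ n) ^ q ^ n
        ≤ ∑ m ∈ Finset.range (N + 1), entryNorm (expCoeff F θ B m) * (ρ ^ m) ^ q ^ m :=
          Finset.single_le_sum (f := fun m => entryNorm (expCoeff F θ B m) * (ρ ^ m) ^ q ^ m)
            (fun m _ => hterm m) (Finset.mem_range.2 hn)
      _ ≤ c := by simp [c]
      _ ≤ c ^ q ^ n := le_self_pow₀ hc1 (card_pow_ne_zero F n)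
  · obtain ⟨m, rfl⟩ : ∃ m, n = m + 1 := ⟨n - 1, by omega⟩
    set Q := q ^ (m + 1) with hQ
    have hQn : N ≤ Q := by
      have : m + 1 < Q := lt_card_pow F (m + 1)
      omega
    have hθQ : (0 : ℝ) < ‖θ‖ ^ Q := by positivity
    rw [expCoeff]
    have hsm : ∀ M : Matrix (Fin d) (Fin d) C,
        entryNorm ((θ ^ Fintype.card F ^ (m + 1) - θ)⁻¹ • M) ≤ (‖θ‖ ^ Q)⁻¹ * entryNorm M := by
      intro M
      refine entryNorm_le (mul_nonneg (by positivity) (norm_nonneg _)) fun i j => ?_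
      rw [Matrix.smul_apply, smul_eq_mul, norm_mul, norm_inv,
        norm_pow_sub_self F hθ (Nat.succ_ne_zero m)]
      exact mul_le_mul_of_nonneg_left (norm_entry_le M i j) (by positivity)
    refine (hsm _).trans ?_
    rw [inv_mul_le_iff₀ hθQ]
    have hrhs : 0 ≤ ‖θ‖ ^ Q * (c / ρ ^ (m + 1)) ^ Q := by positivity
    refine entryNorm_le hrhs fun i k => ?_
    rw [Matrix.sum_apply]
    refine IsUltrametricDist.norm_sum_le_of_forall_le_of_nonneg hrhs fun j _ => ?_
    refine (norm_entry_le _ i k).trans ((entryNorm_mul_le _ _).trans ?_)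
    by_cases hj : r < m + 1 - j
    · rw [hr _ hj]
      have h0 : entryNorm (0 : Matrix (Fin d) (Fin d) C) ≤ 0 := entryNorm_le le_rfl (by simp)
      have h1 : entryNorm (0 : Matrix (Fin d) (Fin d) C) = 0 := le_antisymm h0 (norm_nonneg _)
      rw [h1, zero_mul]
      exact hrhs
    · have hjm : (j : ℕ) < m + 1 := j.2
      have h1 : entryNorm (twist F (m + 1 - j) (expCoeff F θ B j)) ≤ (c / ρ ^ (j : ℕ)) ^ Q := by
        refine (entryNorm_twist_le F _ _).trans ?_
        refine (pow_le_pow_left₀ (norm_nonneg _) (ih j hjm) _).trans (le_of_eq ?_)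
        rw [← pow_mul, ← pow_add, Nat.add_sub_cancel' hjm.le]
      calc entryNorm (B (m + 1 - j)) * entryNorm (twist F (m + 1 - j) (expCoeff F θ B j))
          ≤ ρ ^ Q * (c / ρ ^ (j : ℕ)) ^ Q := by
            refine mul_le_mul ((hβ _).trans (hN.trans ?_)) h1 (norm_nonneg _) (by positivity)
            exact pow_le_pow_right₀ hρ1.le hQn
        _ = (ρ * c / ρ ^ (j : ℕ)) ^ Q := by rw [← mul_pow, mul_div_assoc]
        _ ≤ (‖θ‖ * (c / ρ ^ (m + 1))) ^ Q := by
            refine pow_le_pow_left₀ (by positivity) ?_ _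
            rw [← hρ, ← mul_div_assoc, div_le_div_iff₀ (by positivity) (by positivity)]
            have h2 : ρ * ρ ^ (m + 1) ≤ ρ ^ (2 * (r + 1)) * ρ ^ (j : ℕ) := by
              rw [← pow_succ', ← pow_add]
              exact pow_le_pow_right₀ hρ1.le (by omega)
            nlinarith
        _ = ‖θ‖ ^ Q * (c / ρ ^ (m + 1)) ^ Q := mul_pow _ _ _

variable [CompleteSpace C]

lemma summable_expSeries {e : ℕ → Matrix (Fin d) (Fin d) C} {c ρ : ℝ} (hc : 1 ≤ c) (hρ : 1 < ρ)
    (he : ∀ n, entryNorm (e n) ≤ (c / ρ ^ n) ^ Fintype.card F ^ n) (x : Fin d → C) :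
    Summable fun n => (e n).mulVec (tau F n x) := by
  have hρ0 : 0 < ρ := zero_lt_one.trans hρ
  obtain ⟨N, hN⟩ := pow_unbounded_of_one_lt (2 * c * ‖x‖) hρ
  refine Summable.of_norm_bounded_eventually_nat (g := fun n : ℕ => (1 / 2 : ℝ) ^ n)
    (summable_geometric_of_lt_one (by norm_num) (by norm_num)) ?_
  filter_upwards [Filter.eventually_ge_atTop N] with n hn
  have h1 : c / ρ ^ n * ‖x‖ ≤ 1 / 2 := by
    rw [div_mul_eq_mul_div, div_le_iff₀ (by positivity)]
    have := pow_le_pow_right₀ hρ.le hn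
    linarith
  calc ‖(e n).mulVec (tau F n x)‖ ≤ entryNorm (e n) * ‖tau F n x‖ := norm_mulVec_le _ _
    _ ≤ (c / ρ ^ n) ^ Fintype.card F ^ n * ‖x‖ ^ Fintype.card F ^ n :=
        mul_le_mul (he n) (norm_tau_le F n x) (norm_nonneg _) (by positivity)
    _ = (c / ρ ^ n * ‖x‖) ^ Fintype.card F ^ n := (mul_pow _ _ _).symm
    _ ≤ (1 / 2) ^ Fintype.card F ^ n := pow_le_pow_left₀ (by positivity) h1 _
    _ ≤ (1 / 2) ^ n := pow_le_pow_of_le_one (by norm_num) (by norm_num) (lt_card_pow F n).le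

/-- Existence of the exponential on coordinate vectors: for commuting families `M a` of twisted
polynomials, one of which has scalar expanding linear part. -/
lemma exists_expSeries {ι : Type*} (M : ι → ℕ →₀ Matrix (Fin d) (Fin d) C)
    (a : ι) {θ : C} (hθ : 1 < ‖θ‖) (ha : M a 0 = θ • 1)
    (hcomm : ∀ b x, twistedEval F (M a) (twistedEval F (M b) x) =
      twistedEval F (M b) (twistedEval F (M a) x)) :
    ∃ (f : (Fin d → C) → Fin d → C) (e : ℕ → Matrix (Fin d) (Fin d) C), e 0 = 1 ∧
      (∀ x, HasSum (fun n => (e n).mulVec (tau F n x)) (f x)) ∧ Continuous f ∧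
      (∀ x y, f (x + y) = f x + f y) ∧
      ∀ b x, f ((M b 0).mulVec x) = twistedEval F (M b) (f x) := by
  classical
  let e := expCoeff F θ (M a)
  obtain ⟨c, ρ, hc, hρ, hcρ⟩ := exists_expCoeff_bound F hθ (M a) ((M a).support.sup id) (by
    intro i hi
    by_contra h
    have := Finset.le_sup (f := id) (Finsupp.mem_support_iff.2 h)
    simp only [id] at this
    omega)
  have hρ0 : 0 < ρ := zero_lt_one.trans hρ
  have hc0 : 0 < c := zero_lt_one.trans_le hc
  let f : (Fin d → C) → Fin d → C := fun x => ∑' n, (e n).mulVec (tau F n x)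
  have hf : ∀ x, HasSum (fun n => (e n).mulVec (tau F n x)) (f x) := fun x =>
    (summable_expSeries F hc hρ hcρ x).hasSum
  have he0 : e 0 = 1 := by simp only [e]; rw [expCoeff]
  have hadd : ∀ x y, f (x + y) = f x + f y := by
    intro x y
    refine (hf (x + y)).unique ?_
    simpa only [tau_add, Matrix.mulVec_add] using (hf x).add (hf y)
  let fa : (Fin d → C) →+ (Fin d → C) := AddMonoidHom.mk' f hadd
  -- quadratic approximation near zero
  have hquad : ∀ x : Fin d → C, c * ‖x‖ ≤ 1 → ‖f x - x‖ ≤ c ^ 2 * ‖x‖ ^ 2 := by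
    intro x hx
    have h1 := (hasSum_nat_add_iff' 1).2 (hf x)
    simp only [Finset.range_one, Finset.sum_singleton, he0, Matrix.one_mulVec, tau_zero_left] at h1
    rw [← h1.tsum_eq]
    refine IsUltrametricDist.norm_tsum_le_of_forall_le fun n => ?_
    have h2 : c / ρ ^ (n + 1) ≤ c := div_le_self hc0.le (one_le_pow₀ hρ.le)
    calc ‖(e (n + 1)).mulVec (tau F (n + 1) x)‖
        ≤ entryNorm (e (n + 1)) * ‖tau F (n + 1) x‖ := norm_mulVec_le _ _
      _ ≤ c ^ Fintype.card F ^ (n + 1) * ‖x‖ ^ Fintype.card F ^ (n + 1) :=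
          mul_le_mul ((hcρ _).trans (pow_le_pow_left₀ (by positivity) h2 _)) (norm_tau_le F _ x)
            (norm_nonneg _) (by positivity)
      _ = (c * ‖x‖) ^ Fintype.card F ^ (n + 1) := (mul_pow _ _ _).symm
      _ ≤ (c * ‖x‖) ^ 2 :=
          pow_le_pow_of_le_one (by positivity) hx (two_le_card_pow F (Nat.succ_ne_zero n))
      _ = c ^ 2 * ‖x‖ ^ 2 := mul_pow _ _ _
  have hsmall : ∀ x : Fin d → C, c ^ 2 * ‖x‖ ≤ 1 → ‖f x‖ ≤ ‖x‖ := by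
    intro x hx
    have hx' : c * ‖x‖ ≤ 1 := by nlinarith [norm_nonneg x]
    have h1 : ‖f x - x‖ ≤ ‖x‖ := (hquad x hx').trans (by nlinarith [norm_nonneg x])
    have h2 : f x = (f x - x) + x := by abel
    rw [h2]
    exact (IsUltrametricDist.norm_add_le_max _ _).trans (max_le h1 le_rfl)
  have hcont : Continuous f := by
    refine continuous_of_continuousAt_zero fa ?_
    have h0 : fa 0 = 0 := map_zero fa
    rw [ContinuousAt, h0, Metric.tendsto_nhds_nhds]
    intro ε hε
    refine ⟨min ε (1 / c ^ 2), by positivity, fun {x} hx => ?_⟩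
    rw [dist_zero_right] at hx ⊢
    have h1 : c ^ 2 * ‖x‖ ≤ 1 := by
      have := (hx.trans_le (min_le_right _ _)).le
      rw [le_div_iff₀ (by positivity)] at this
      linarith
    exact (hsmall x h1).trans_lt (hx.trans_le (min_le_left _ _))
  -- functional equation for the distinguished element
  have hfe : ∀ x, f (θ • x) = twistedEval F (M a) (f x) := by
    intro x
    refine (hf (θ • x)).unique ?_
    let G : ℕ → ℕ → Fin d → C := fun i n => (M a i).mulVec (tau F i ((e n).mulVec (tau F n x)))
    let H : ℕ → ℕ → Fin d → C := fun i m => if i ≤ m then G i (m - i) else 0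
    have hG : ∀ i, HasSum (G i) ((M a i).mulVec (tau F i (f x))) := by
      intro i
      let g : (Fin d → C) →+ (Fin d → C) := AddMonoidHom.mk' (fun y => (M a i).mulVec (tau F i y))
        (fun y z => by rw [tau_add, Matrix.mulVec_add])
      have hg : Continuous g := by
        change Continuous fun y => (M a i).mulVec (tau F i y)
        unfold Matrix.mulVec dotProduct tau
        fun_prop
      exact (hf x).map g hg
    have hH : ∀ i, HasSum (H i) ((M a i).mulVec (tau F i (f x))) := by
      intro i
      have hinj : Function.Injective fun n : ℕ => n + i := add_left_injective i
      refine (hinj.hasSum_iff ?_).1 ?_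
      · intro m hm
        simp only [H]
        rw [if_neg]
        intro him
        exact hm ⟨m - i, Nat.sub_add_cancel him⟩
      · have : H i ∘ (fun n => n + i) = G i := by
          funext n
          simp [H]
        rw [this]
        exact hG i
    have hsum := hasSum_sum (s := (M a).support) fun i _ => hH i
    have hval : ∑ i ∈ (M a).support, (M a i).mulVec (tau F i (f x)) = twistedEval F (M a) (f x) :=
      rfl
    rw [hval] at hsum
    convert hsum using 2 with m
    rw [tau_smul, Matrix.mulVec_smul, ← Matrix.smul_mulVec, expCoeff_smul F hθ (M a) ha,
      Matrix.sum_mulVec]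
    let h : ℕ → Fin d → C := fun i => ((M a i) * twist F i (e (m - i))).mulVec (tau F m x)
    have hl : ∀ j ∈ Finset.range (m + 1),
        ((M a (m - j)) * twist F (m - j) (expCoeff F θ (M a) j)).mulVec (tau F m x) =
          h (m + 1 - 1 - j) := by
      intro j hj
      rw [Finset.mem_range] at hj
      simp only [h, e, Nat.add_sub_cancel, Nat.sub_sub_self (Nat.lt_succ_iff.1 hj)]
    rw [Finset.sum_congr rfl hl, Finset.sum_range_reflect h (m + 1)]
    have hr : ∀ i, H i m = if i ∈ Finset.range (m + 1) then h i else 0 := by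
      intro i
      by_cases hi : i ≤ m
      · rw [if_pos (Finset.mem_range.2 (Nat.lt_succ_of_le hi))]
        simp only [H, G, h, if_pos hi, tau_mulVec, tau_tau, Matrix.mulVec_mulVec,
          Nat.add_sub_cancel' hi]
      · rw [if_neg (by simpa using hi)]
        simp only [H, if_neg hi]
    rw [Finset.sum_congr rfl fun i _ => hr i, Finset.sum_ite_mem]
    symm
    refine Finset.sum_subset Finset.inter_subset_right fun i hi hi' => ?_
    have h0 : M a i = 0 := by
      by_contra hne
      exact hi' (Finset.mem_inter.2 ⟨Finsupp.mem_support_iff.2 hne, hi⟩)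
    simp only [h, h0, zero_mul, Matrix.zero_mulVec]
  -- equivariance
  refine ⟨f, e, he0, hf, hcont, hadd, fun b => ?_⟩
  let D : (Fin d → C) → Fin d → C := fun x => f ((M b 0).mulVec x) - twistedEval F (M b) (f x)
  suffices hD : ∀ x, D x = 0 from fun x => sub_eq_zero.1 (hD x)
  have hDθ : ∀ x, D (θ • x) = twistedEval F (M a) (D x) := by
    intro x
    let T : (Fin d → C) →+ (Fin d → C) :=
      AddMonoidHom.mk' (twistedEval F (M a)) (twistedEval_add F (M a))
    change _ = T _
    simp only [D]
    rw [map_sub, Matrix.mulVec_smul, hfe, hfe, ← hcomm]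
    rfl
  obtain ⟨α, hα0, hα⟩ := exists_twistedEval_bound F (M a)
  obtain ⟨β, hβ0, hβ⟩ := exists_twistedEval_bound F (M b)
  set μ := entryNorm (M b 0) with hμ
  have hμ0 : 0 ≤ μ := entryNorm_nonneg _
  -- `D` is quadratically small near zero
  obtain ⟨κ, δ, hκ, hδ, hDquad⟩ : ∃ κ δ : ℝ, 0 ≤ κ ∧ 0 < δ ∧
      ∀ x : Fin d → C, ‖x‖ ≤ δ → ‖D x‖ ≤ κ * ‖x‖ ^ 2 := by
    refine ⟨c ^ 2 * μ ^ 2 + β + μ * c ^ 2, ((c ^ 2 + 1) * (μ + 1))⁻¹, by positivity,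
      by positivity, fun x hx => ?_⟩
    have hx0 := norm_nonneg x
    have hx1 : (c ^ 2 + 1) * (μ + 1) * ‖x‖ ≤ 1 := by
      have := mul_le_mul_of_nonneg_left hx (by positivity : 0 ≤ (c ^ 2 + 1) * (μ + 1))
      rwa [mul_inv_cancel₀ (by positivity)] at this
    have p1 : 0 ≤ c ^ 2 * ‖x‖ := by positivity
    have p2 : 0 ≤ μ * ‖x‖ := by positivity
    have p3 : 0 ≤ c ^ 2 * (μ * ‖x‖) := by positivity
    have p4 : c ^ 2 * (μ * ‖x‖) + c ^ 2 * ‖x‖ + μ * ‖x‖ + ‖x‖ ≤ 1 := by linarith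
    have hcc : c ≤ c ^ 2 := le_self_pow₀ hc two_ne_zero
    have h1 : c ^ 2 * ‖x‖ ≤ 1 := by linarith
    have h2 : ‖x‖ ≤ 1 := by linarith
    have h3 : c * ‖x‖ ≤ 1 := (mul_le_mul_of_nonneg_right hcc hx0).trans h1
    have h4 : c * ‖(M b 0).mulVec x‖ ≤ 1 := by
      refine (mul_le_mul hcc (norm_mulVec_le _ _) (norm_nonneg _) (by positivity)).trans ?_
      linarith
    have hfx := hsmall x h1
    have e1 : ‖f ((M b 0).mulVec x) - (M b 0).mulVec x‖ ≤ c ^ 2 * μ ^ 2 * ‖x‖ ^ 2 := by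
      refine (hquad _ h4).trans ?_
      have h5 : ‖(M b 0).mulVec x‖ ^ 2 ≤ (μ * ‖x‖) ^ 2 :=
        pow_le_pow_left₀ (norm_nonneg _) (norm_mulVec_le _ _) _
      rw [mul_assoc, ← mul_pow μ]
      exact mul_le_mul_of_nonneg_left h5 (sq_nonneg c)
    have e2 : ‖twistedEval F (M b) (f x) - (M b 0).mulVec (f x)‖ ≤ β * ‖x‖ ^ 2 :=
      (hβ _ (hfx.trans h2)).trans
        (mul_le_mul_of_nonneg_left (pow_le_pow_left₀ (norm_nonneg _) hfx _) hβ0)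
    have e3 : ‖(M b 0).mulVec (f x) - (M b 0).mulVec x‖ ≤ μ * c ^ 2 * ‖x‖ ^ 2 := by
      rw [← Matrix.mulVec_sub]
      refine (norm_mulVec_le _ _).trans ?_
      rw [mul_assoc]
      exact mul_le_mul_of_nonneg_left (hquad x h3) hμ0
    have hdec : D x = (f ((M b 0).mulVec x) - (M b 0).mulVec x)
        - (twistedEval F (M b) (f x) - (M b 0).mulVec (f x))
        - ((M b 0).mulVec (f x) - (M b 0).mulVec x) := by
      simp only [D]; abel
    rw [hdec]
    refine (norm_sub_le _ _).trans ?_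
    have := norm_sub_le (f ((M b 0).mulVec x) - (M b 0).mulVec x)
      (twistedEval F (M b) (f x) - (M b 0).mulVec (f x))
    linarith
  -- expansion of the distinguished twisted polynomial
  have hexp : ∀ y : Fin d → C, ‖y‖ ≤ (α + 1)⁻¹ → ‖twistedEval F (M a) y‖ ≤ ‖θ‖ * ‖y‖ := by
    intro y hy
    have hy1 : (α + 1) * ‖y‖ ≤ 1 := by
      have := mul_le_mul_of_nonneg_left hy (by positivity : 0 ≤ α + 1)
      rwa [mul_inv_cancel₀ (by positivity)] at this
    have hy0 := norm_nonneg y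
    have hy2 : ‖y‖ ≤ 1 := by nlinarith
    have h1 := hα y hy2
    rw [ha, Matrix.smul_mulVec, Matrix.one_mulVec] at h1
    have h2 : twistedEval F (M a) y = (twistedEval F (M a) y - θ • y) + θ • y := by abel
    rw [h2]
    refine (IsUltrametricDist.norm_add_le_max _ _).trans (max_le (h1.trans ?_) (norm_smul_le _ _))
    have h3 : α * ‖y‖ ≤ ‖θ‖ := by nlinarith
    nlinarith
  have hiter : ∀ (k : ℕ) (y : Fin d → C), ‖θ‖ ^ k * ‖y‖ ≤ (α + 1)⁻¹ →
      ‖(twistedEval F (M a))^[k] y‖ ≤ ‖θ‖ ^ k * ‖y‖ := by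
    intro k
    induction k with
    | zero => intro y _; simp
    | succ k ih =>
      intro y hy
      have hk : ‖θ‖ ^ k * ‖y‖ ≤ ‖θ‖ ^ (k + 1) * ‖y‖ :=
        mul_le_mul_of_nonneg_right (pow_le_pow_right₀ hθ.le (Nat.le_succ k)) (norm_nonneg _)
      have h1 := ih y (hk.trans hy)
      rw [Function.iterate_succ_apply']
      refine (hexp _ (h1.trans (hk.trans hy))).trans ?_
      rw [pow_succ', mul_assoc]
      exact mul_le_mul_of_nonneg_left h1 (norm_nonneg _)
  intro x
  have hθ0 : θ ≠ 0 := norm_ne_zero_iff.1 (by positivity)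
  have hDk : ∀ k : ℕ, D x = (twistedEval F (M a))^[k] (D ((θ⁻¹) ^ k • x)) := by
    intro k
    induction k with
    | zero => simp
    | succ k ih =>
      rw [Function.iterate_succ_apply, ← hDθ, smul_smul, pow_succ', ← mul_assoc,
        mul_inv_cancel₀ hθ0, one_mul]
      exact ih
  have htend : Filter.Tendsto (fun k : ℕ => κ * ‖x‖ ^ 2 * (‖θ‖⁻¹) ^ k) Filter.atTop (nhds 0) := by
    simpa using (tendsto_pow_atTop_nhds_zero_of_lt_one (by positivity)
      (inv_lt_one_of_one_lt₀ hθ)).const_mul (κ * ‖x‖ ^ 2)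
  have htend2 : Filter.Tendsto (fun k : ℕ => ‖x‖ * (‖θ‖⁻¹) ^ k) Filter.atTop (nhds 0) := by
    simpa using (tendsto_pow_atTop_nhds_zero_of_lt_one (by positivity)
      (inv_lt_one_of_one_lt₀ hθ)).const_mul ‖x‖
  have hle : ∀ᶠ k : ℕ in Filter.atTop, ‖D x‖ ≤ κ * ‖x‖ ^ 2 * (‖θ‖⁻¹) ^ k := by
    filter_upwards [htend.eventually_le_const (by positivity : (0 : ℝ) < (α + 1)⁻¹),
      htend2.eventually_le_const hδ] with k hk1 hk2
    have hnx : ‖(θ⁻¹) ^ k • x‖ ≤ ‖x‖ * (‖θ‖⁻¹) ^ k := by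
      refine (norm_smul_le _ _).trans (le_of_eq ?_)
      rw [norm_pow, norm_inv, mul_comm]
    have h1 : ‖D ((θ⁻¹) ^ k • x)‖ ≤ κ * (‖x‖ * (‖θ‖⁻¹) ^ k) ^ 2 :=
      (hDquad _ (hnx.trans hk2)).trans
        (mul_le_mul_of_nonneg_left (pow_le_pow_left₀ (norm_nonneg _) hnx _) hκ)
    have h2 : ‖θ‖ ^ k * ‖D ((θ⁻¹) ^ k • x)‖ ≤ κ * ‖x‖ ^ 2 * (‖θ‖⁻¹) ^ k := by
      refine (mul_le_mul_of_nonneg_left h1 (by positivity)).trans (le_of_eq ?_)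
      have h3 : ‖θ‖ ^ k * (‖θ‖⁻¹) ^ k = 1 := by
        rw [← mul_pow, mul_inv_cancel₀ (by positivity), one_pow]
      linear_combination (κ * ‖x‖ ^ 2 * (‖θ‖⁻¹) ^ k) * h3
    rw [hDk k]
    exact (hiter k _ (h2.trans hk1)).trans h2
  have h0 : ‖D x‖ ≤ 0 := ge_of_tendsto htend hle
  exact norm_le_zero_iff.1 h0

end Convergence
end AndersonModule

/-! ### Completed tensor products -/

section GaussCompletion

variable (F : Type*) [Field F]

/-- The tensor product `B ⊗ V` over `F` of an `F`-algebra `B` with a normed `F`-vector space `V`,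
as a type carrying the Gauss norm. -/
def GaussTensor (B V : Type*) [CommRing B] [Algebra F B] [AddCommGroup V] [Module F V] : Type _ :=
  B ⊗[F] V

namespace GaussTensor

section Basic

variable (B V : Type*) [CommRing B] [Algebra F B] [SeminormedAddCommGroup V] [Module F V]

noncomputable instance : AddCommGroup (GaussTensor F B V) := inferInstanceAs (AddCommGroup (B ⊗[F] V))

noncomputable instance : Module B (GaussTensor F B V) := inferInstanceAs (Module B (B ⊗[F] V))

variable {F B V}

/-- The real number `r` bounds all `‖v_i‖` for some representation `x = ∑ b_i ⊗ v_i`. -/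
def IsRepBound (x : B ⊗[F] V) (r : ℝ) : Prop :=
  0 ≤ r ∧ ∃ (n : ℕ) (b : Fin n → B) (v : Fin n → V), x = ∑ i, b i ⊗ₜ[F] v i ∧ ∀ i, ‖v i‖ ≤ r

lemma isRepBound_zero : IsRepBound (0 : B ⊗[F] V) 0 :=
  ⟨le_rfl, 0, Fin.elim0, Fin.elim0, by simp, fun i => i.elim0⟩

lemma IsRepBound.add {x y : B ⊗[F] V} {r s : ℝ} (hx : IsRepBound x r) (hy : IsRepBound y s) :
    IsRepBound (x + y) (max r s) := by
  obtain ⟨hr, n, b, v, rfl, hv⟩ := hx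
  obtain ⟨hs, m, b2, v2, rfl, hv2⟩ := hy
  refine ⟨hr.trans (le_max_left _ _), n + m, Fin.append b b2, Fin.append v v2, ?_, ?_⟩
  · simp [Fin.sum_univ_add]
  · intro i
    refine Fin.addCases (fun i => ?_) (fun i => ?_) i
    · simpa using Or.inl (hv i)
    · simpa using Or.inr (hv2 i)

lemma IsRepBound.neg {x : B ⊗[F] V} {r : ℝ} (hx : IsRepBound x r) : IsRepBound (-x) r := by
  obtain ⟨hr, n, b, v, rfl, hv⟩ := hx
  refine ⟨hr, n, b, fun i => -v i, ?_, fun i => by rw [norm_neg]; exact hv i⟩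
  simp [TensorProduct.tmul_neg]

lemma exists_isRepBound (x : B ⊗[F] V) : ∃ r, IsRepBound x r := by
  induction x using TensorProduct.induction_on with
  | zero => exact ⟨0, isRepBound_zero⟩
  | tmul b v => exact ⟨‖v‖, norm_nonneg _, 1, fun _ => b, fun _ => v, by simp, fun _ => le_rfl⟩
  | add x y hx hy =>
    obtain ⟨r, hr⟩ := hx
    obtain ⟨s, hs⟩ := hy
    exact ⟨_, hr.add hs⟩

/-- The Gauss norm: the infimum of `max_i ‖v_i‖` over all representations `x = ∑ b_i ⊗ v_i`. -/
noncomputable def gaussNorm (x : B ⊗[F] V) : ℝ := sInf {r | IsRepBound x r}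

lemma gaussNorm_le {x : B ⊗[F] V} {r : ℝ} (h : IsRepBound x r) : gaussNorm x ≤ r :=
  csInf_le ⟨0, fun _ hs => hs.1⟩ h

lemma exists_isRepBound_lt {x : B ⊗[F] V} {r : ℝ} (h : gaussNorm x < r) :
    ∃ s < r, IsRepBound x s := by
  obtain ⟨s, hs, hsr⟩ := exists_lt_of_csInf_lt (exists_isRepBound x) h
  exact ⟨s, hsr, hs⟩

lemma gaussNorm_nonneg (x : B ⊗[F] V) : 0 ≤ gaussNorm x :=
  le_csInf (exists_isRepBound x) fun _ hs => hs.1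

noncomputable instance : SeminormedAddCommGroup (GaussTensor F B V) :=
  AddGroupSeminorm.toSeminormedAddCommGroup
    { toFun := fun x => gaussNorm (F := F) (B := B) (V := V) x
      map_zero' := le_antisymm (gaussNorm_le isRepBound_zero) (gaussNorm_nonneg _)
      add_le' := fun x y => by
        refine le_of_forall_pos_le_add fun ε hε => ?_
        obtain ⟨r, hr, hxr⟩ := exists_isRepBound_lt (F := F) (B := B) (V := V) (x := x)
          (lt_add_of_pos_right _ (half_pos hε))
        obtain ⟨s, hs, hys⟩ := exists_isRepBound_lt (F := F) (B := B) (V := V) (x := y)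
          (lt_add_of_pos_right _ (half_pos hε))
        have h1 := gaussNorm_le (hxr.add hys)
        have h2 : max r s ≤ r + s := max_le_add_of_nonneg hxr.1 hys.1
        refine h1.trans ?_
        linarith
      neg' := fun x => by
        have key : ∀ y : B ⊗[F] V, gaussNorm (-y) ≤ gaussNorm y := fun y =>
          le_csInf (exists_isRepBound y) fun _ hs => gaussNorm_le hs.neg
        refine le_antisymm (key x) ?_
        have h := key (-x)
        have h2 : -(-x : B ⊗[F] V) = x := neg_neg x
        exact (congrArg gaussNorm h2).symm.le.trans h }

lemma norm_def (x : GaussTensor F B V) : ‖x‖ = gaussNorm (F := F) (B := B) (V := V) x := rfl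

end Basic

variable {F}
variable {B B' V W : Type*} [CommRing B] [Algebra F B] [CommRing B'] [Algebra F B']
  [SeminormedAddCommGroup V] [Module F V] [SeminormedAddCommGroup W] [Module F W]

/-- The additive map `f ⊗ g`. -/
noncomputable def map (f : B →ₗ[F] B') (g : V →ₗ[F] W) :
    GaussTensor F B V →+ GaussTensor F B' W :=
  (TensorProduct.map f g).toAddMonoidHom

lemma map_id_smul (g : V →ₗ[F] W) (b : B) (x : GaussTensor F B V) :
    map (LinearMap.id : B →ₗ[F] B) g (b • x) = b • map (LinearMap.id : B →ₗ[F] B) g x := by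
  refine TensorProduct.induction_on (motive := fun x : B ⊗[F] V =>
    TensorProduct.map (LinearMap.id : B →ₗ[F] B) g (b • x) =
      b • TensorProduct.map (LinearMap.id : B →ₗ[F] B) g x) x ?_ ?_ ?_
  · simp
  · intro c v
    simp [TensorProduct.smul_tmul']
  · intro x y hx hy
    rw [smul_add, map_add, map_add, hx, hy, smul_add]

lemma continuous_map (f : B →ₗ[F] B') (g : V →ₗ[F] W) (hg : Continuous g) :
    Continuous (map f g) := by
  refine continuous_of_continuousAt_zero (map f g) ?_
  rw [ContinuousAt, map_zero, Metric.tendsto_nhds_nhds]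
  intro ε hε
  have h0 := hg.tendsto 0
  rw [map_zero, Metric.tendsto_nhds_nhds] at h0
  obtain ⟨δ, hδ, h⟩ := h0 (ε / 2) (half_pos hε)
  refine ⟨δ, hδ, fun {x} hx => ?_⟩
  rw [dist_zero_right, norm_def] at hx ⊢
  obtain ⟨s, hs, -, n, b, v, hxe, hv⟩ := exists_isRepBound_lt hx
  have hrep : IsRepBound (F := F) (B := B') (V := W) (map f g x) (ε / 2) := by
    refine ⟨(half_pos hε).le, n, fun i => f (b i), fun i => g (v i), ?_, fun i => ?_⟩
    · have h1 : map f g x = TensorProduct.map f g (∑ i, b i ⊗ₜ[F] v i) :=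
        congrArg (TensorProduct.map f g) hxe
      rw [h1, map_sum]
      rfl
    · have h2 := h (x := v i) (by rw [dist_zero_right]; exact (hv i).trans_lt hs)
      rw [dist_zero_right] at h2
      exact h2.le
  exact (gaussNorm_le hrep).trans_lt (half_lt_self hε)

instance : UniformContinuousConstSMul B (GaussTensor F B V) where
  uniformContinuous_const_smul b := by
    have h : Continuous (map (F := F) (LinearMap.mulLeft F b) (LinearMap.id : V →ₗ[F] V)) :=
      continuous_map _ _ continuous_id
    have h2 := uniformContinuous_addMonoidHom_of_continuous h
    have h3 : ∀ x : GaussTensor F B V,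
        map (F := F) (LinearMap.mulLeft F b) (LinearMap.id : V →ₗ[F] V) x = b • x := by
      intro x
      refine TensorProduct.induction_on (motive := fun x : B ⊗[F] V =>
        TensorProduct.map (LinearMap.mulLeft F b) (LinearMap.id : V →ₗ[F] V) x = b • x) x ?_ ?_ ?_
      · simp
      · intro c v
        simp [TensorProduct.smul_tmul']
      · intro x y hx hy
        rw [map_add, smul_add, hx, hy]
    exact (funext h3 : ⇑(map (F := F) (LinearMap.mulLeft F b) (LinearMap.id : V →ₗ[F] V)) =
      fun x => b • x) ▸ h2

end GaussTensor

/-- The completed tensor product `B ⊗̂ V`. -/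
abbrev CompletedTensor (B V : Type*) [CommRing B] [Algebra F B] [SeminormedAddCommGroup V]
    [Module F V] : Type _ :=
  UniformSpace.Completion (GaussTensor F B V)

namespace CompletedTensor

variable {F}
variable {B B' V W : Type*} [CommRing B] [Algebra F B] [CommRing B'] [Algebra F B']
  [SeminormedAddCommGroup V] [Module F V] [SeminormedAddCommGroup W] [Module F W]

/-- The canonical map `B ⊗ V → B ⊗̂ V`. -/
noncomputable def ofTensor : B ⊗[F] V →+ CompletedTensor F B V :=
  (UniformSpace.Completion.toCompl : GaussTensor F B V →+ CompletedTensor F B V)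

/-- The continuous extension `f ⊗̂ g : B ⊗̂ V → B' ⊗̂ W` of `f ⊗ g`, for continuous `g`. -/
noncomputable def map (f : B →ₗ[F] B') (g : V →ₗ[F] W) (hg : Continuous g) :
    CompletedTensor F B V →+ CompletedTensor F B' W :=
  (GaussTensor.map f g).completion (GaussTensor.continuous_map f g hg)

lemma map_ofTensor (f : B →ₗ[F] B') (g : V →ₗ[F] W) (hg : Continuous g) (x : B ⊗[F] V) :
    map f g hg (ofTensor x) = ofTensor (TensorProduct.map f g x) :=
  AddMonoidHom.completion_coe _ (GaussTensor.continuous_map f g hg) _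

lemma continuous_map (f : B →ₗ[F] B') (g : V →ₗ[F] W) (hg : Continuous g) :
    Continuous (map f g hg) :=
  AddMonoidHom.continuous_completion _ _

lemma map_id_smul (g : V →ₗ[F] W) (hg : Continuous g) (b : B) (ω : CompletedTensor F B V) :
    map LinearMap.id g hg (b • ω) = b • map (LinearMap.id : B →ₗ[F] B) g hg ω := by
  induction ω using UniformSpace.Completion.induction_on with
  | hp =>
    exact isClosed_eq ((continuous_map _ _ _).comp (continuous_const_smul b))
      (Continuous.const_smul (continuous_map LinearMap.id g hg) b)
  | ih x =>
    rw [← UniformSpace.Completion.coe_smul]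
    unfold map
    rw [AddMonoidHom.completion_coe, AddMonoidHom.completion_coe,
      ← UniformSpace.Completion.coe_smul, GaussTensor.map_id_smul]

end CompletedTensor

end GaussCompletion

/-! ### The coefficient ring and the field `ℂ_∞` -/

/-- `A` is the ring of functions regular outside a closed point `∞` on a smooth projective
geometrically irreducible curve `X` over the finite field `F`, and `K` is its function field.
In other words, `Spec A = X ∖ {∞}` is a regular (equivalently, smooth, as `F` is perfect) affine
curve over `F`, `F` is algebraically closed in `K` (equivalently, the curve is geometrically
irreducible), and exactly one place of `K` is not centred on `Spec A`.
Every valuation ring of `K` contains the finite field `F`, so the places of `K` are its valuation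
subrings other than `K`, and `K` itself contains `A`. -/
class IsCoefficientRing (F A K : Type*) [Field F] [CommRing A] [IsDedekindDomain A] [Algebra F A]
    [Field K] [Algebra F K] [Algebra A K] [IsFractionRing A K] : Prop where
  finiteType : Algebra.FiniteType F A
  not_isField : ¬ IsField A
  algebraic_mem : ∀ x : K, IsAlgebraic F x → x ∈ Set.range (algebraMap F K)
  existsUnique_place : ∃! W : ValuationSubring K, ∃ a : A, algebraMap A K a ∉ W

/-- The complete ultrametric field `C` is the completion, at a place above `∞`, of an algebraic
closure of `K`: its norm restricts on `K` to an absolute value belonging to the place `∞`, and the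
algebraic closure of `K` in `C` is algebraically closed and dense. -/
class IsCInfty (A K C : Type*) [CommRing A] [Field K] [Algebra A K] [NormedField C]
    [CompleteSpace C] [IsUltrametricDist C] [Algebra K C] : Prop where
  mem_iff_norm_le_one : ∀ W : ValuationSubring K, (∃ a : A, algebraMap A K a ∉ W) →
    ∀ x : K, x ∈ W ↔ ‖algebraMap K C x‖ ≤ 1
  isAlgClosed : IsAlgClosed (algebraicClosure K C)
  dense : Dense ((algebraicClosure K C : IntermediateField K C) : Set C)

/-! ### Anderson modules -/

/-- An Anderson `A`-module `(E, φ)` of dimension `d` over the intermediate field `L` of `C / K`.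
In coordinates `E ≅ 𝔾_a ^ d`, the ring of endomorphisms of the `F`-vector space scheme `E` over `L`
is the ring of twisted polynomials `∑ M_n τ ^ n` with `M_n` a `d × d` matrix over `L` and
`τ M = M ^ {(1)} τ`. The action `φ_a = ∑ (coeff a n) τ ^ n` is a homomorphism of `F`-algebras,
the induced action on the Lie algebra is `∂ φ_a = coeff a 0`, and `∂ φ_a - ℓ(a)` is nilpotent. -/
structure AndersonModule (F A : Type*) {K C : Type*} [Field F] [Fintype F] [CommRing A]
    [Algebra F A] [Field K] [Algebra A K] [NormedField C] [Algebra K C] [Algebra F C]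
    (L : IntermediateField K C) (d : ℕ) where
  coeff : A → ℕ →₀ Matrix (Fin d) (Fin d) C
  coeff_mem : ∀ a n i j, coeff a n i j ∈ L
  coeff_algebraMap : ∀ c : F, coeff (algebraMap F A c) = Finsupp.single 0 (algebraMap F C c • 1)
  coeff_add : ∀ a b, coeff (a + b) = coeff a + coeff b
  coeff_mul : ∀ a b n, coeff (a * b) n = ∑ p ∈ Finset.HasAntidiagonal.antidiagonal n,
    coeff a p.1 * AndersonModule.twist F p.1 (coeff b p.2)
  isNilpotent : ∀ a, IsNilpotent (coeff a 0 - algebraMap K C (algebraMap A K a) • 1)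

namespace AndersonModule

section Module

variable {F A K C : Type*} [Field F] [Fintype F] [CommRing A] [Algebra F A] [Field K] [Algebra A K]
  [NormedField C] [Algebra K C] [Algebra F C] {L : IntermediateField K C} {d : ℕ}

lemma coeff_one (E : AndersonModule F A L d) : E.coeff 1 = Finsupp.single 0 1 := by
  have h := E.coeff_algebraMap 1
  rwa [map_one, map_one, one_smul] at h

lemma coeff_zero (E : AndersonModule F A L d) : E.coeff 0 = 0 := by
  have h := E.coeff_add 0 0
  rwa [add_zero, left_eq_add] at h

lemma coeff_mul_zero (E : AndersonModule F A L d) (a b : A) :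
    E.coeff (a * b) 0 = E.coeff a 0 * E.coeff b 0 := by
  rw [E.coeff_mul]; simp

lemma coeff_pow_zero (E : AndersonModule F A L d) (a : A) (n : ℕ) :
    E.coeff (a ^ n) 0 = E.coeff a 0 ^ n := by
  induction n with
  | zero => simp [coeff_one]
  | succ n ih => rw [pow_succ, pow_succ, coeff_mul_zero, ih]

/-- The group `E(ℂ_∞)`, with the `A`-action through `φ`. -/
def Points (_E : AndersonModule F A L d) : Type _ := Fin d → C

/-- The Lie algebra `Lie_E(ℂ_∞)`, with the `A`-action through `∂ φ`. -/
def Lie (_E : AndersonModule F A L d) : Type _ := Fin d → C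

variable (E : AndersonModule F A L d)

/-- The maximum norm on `E(ℂ_∞)`. -/
noncomputable instance : NormedAddCommGroup E.Points :=
  inferInstanceAs (NormedAddCommGroup (Fin d → C))

/-- The maximum norm on `Lie_E(ℂ_∞)`. -/
noncomputable instance : NormedAddCommGroup E.Lie :=
  inferInstanceAs (NormedAddCommGroup (Fin d → C))

noncomputable instance : Module A E.Points where
  smul a x := twistedEval F (E.coeff a) x
  one_smul x := by
    change twistedEval F (E.coeff 1) x = x
    rw [E.coeff_one]
    exact (Finsupp.sum_single_index (by simp)).trans
      ((Matrix.one_mulVec _).trans (tau_zero_left F x))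
  mul_smul a b x := twistedEval_mul F (E.coeff_mul a b) x
  smul_zero a := twistedEval_zero F _
  smul_add a := twistedEval_add F _
  add_smul a b x := by
    change twistedEval F (E.coeff (a + b)) x = _
    rw [E.coeff_add]
    exact twistedEval_add_left F _ _ x
  zero_smul x := by
    change twistedEval F (E.coeff 0) x = 0
    rw [E.coeff_zero]
    rfl

noncomputable instance : Module A E.Lie where
  smul a x := (E.coeff a 0).mulVec x
  one_smul x := by
    change (E.coeff 1 0).mulVec x = x
    rw [E.coeff_one, Finsupp.single_eq_same]
    exact Matrix.one_mulVec x
  mul_smul a b x := by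
    have h : ∀ y : Fin d → C,
        (E.coeff (a * b) 0).mulVec y = (E.coeff a 0).mulVec ((E.coeff b 0).mulVec y) := fun y => by
      rw [E.coeff_mul_zero, Matrix.mulVec_mulVec]
    exact h x
  smul_zero a := Matrix.mulVec_zero _
  smul_add a := Matrix.mulVec_add _
  add_smul a b x := by
    change (E.coeff (a + b) 0).mulVec x = _
    rw [E.coeff_add]
    exact Matrix.add_mulVec _ _ _
  zero_smul x := by
    change (E.coeff 0 0).mulVec x = 0
    rw [E.coeff_zero]
    exact Matrix.zero_mulVec _

noncomputable instance : Module F E.Points := Module.compHom _ (algebraMap F A)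

noncomputable instance : Module F E.Lie := Module.compHom _ (algebraMap F A)

instance : IsScalarTower F A E.Points where
  smul_assoc c a x := by rw [Algebra.smul_def, mul_smul]; rfl

instance : IsScalarTower F A E.Lie where
  smul_assoc c a x := by rw [Algebra.smul_def, mul_smul]; rfl

/-- The action `φ_a` on `E(ℂ_∞)` as an `F`-linear map. -/
noncomputable def phi (a : A) : E.Points →ₗ[F] E.Points := Algebra.lsmul F F E.Points a

/-- The action `∂ φ_a` on `Lie_E(ℂ_∞)` as an `F`-linear map. -/
noncomputable def dphi (a : A) : E.Lie →ₗ[F] E.Lie := Algebra.lsmul F F E.Lie a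

lemma continuous_phi (a : A) : Continuous (E.phi a) := continuous_twistedEval F (E.coeff a)

lemma continuous_dphi (a : A) : Continuous (E.dphi a) := by
  change Continuous fun x : Fin d → C => (E.coeff a 0).mulVec x
  unfold Matrix.mulVec dotProduct
  fun_prop

/-- `f` is the exponential function of `E`: it is `A`-linear, i.e. `f ((∂ a) x) = a (f x)`, and it
is given by an everywhere convergent series `x + e_1 τ(x) + e_2 τ ^ 2 (x) + ⋯`. -/
def IsExponential (f : E.Lie →ₗ[A] E.Points) : Prop :=
  ∃ e : ℕ → Matrix (Fin d) (Fin d) C, e 0 = 1 ∧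
    ∀ x : Fin d → C, HasSum (fun n => (e n).mulVec (tau F n x)) (f x : Fin d → C)

lemma exists_scalar [Algebra F K] [IsDedekindDomain A] [IsFractionRing A K]
    [IsCoefficientRing F A K] [CompleteSpace C] [IsUltrametricDist C] [IsCInfty A K C] :
    ∃ (a : A) (θ : C), 1 < ‖θ‖ ∧ E.coeff a 0 = θ • 1 := by
  obtain ⟨W, ⟨a, ha⟩, -⟩ := IsCoefficientRing.existsUnique_place (F := F) (A := A) (K := K)
  have hnorm : 1 < ‖algebraMap K C (algebraMap A K a)‖ := by
    rw [← not_le, ← IsCInfty.mem_iff_norm_le_one W ⟨a, ha⟩]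
    exact ha
  set θ := algebraMap K C (algebraMap A K a) with hθ
  obtain ⟨n, hn⟩ := E.isNilpotent a
  obtain ⟨k, hp, hk⟩ := FiniteField.card F (ringChar F)
  have : Fact (ringChar F).Prime := ⟨hp⟩
  have : CharP C (ringChar F) := charP_of_injective_algebraMap (algebraMap F C).injective _
  refine ⟨a ^ Fintype.card F ^ n, θ ^ Fintype.card F ^ n, ?_, ?_⟩
  · rw [norm_pow]
    exact one_lt_pow₀ hnorm (card_pow_ne_zero F n)
  · rw [coeff_pow_zero]
    rcases Nat.eq_zero_or_pos d with rfl | hd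
    · ext i; exact i.elim0
    have : Nonempty (Fin d) := ⟨⟨0, hd⟩⟩
    have hsplit : E.coeff a 0 = θ • 1 + (E.coeff a 0 - θ • 1) := by abel
    have hcomm : Commute (θ • (1 : Matrix (Fin d) (Fin d) C)) (E.coeff a 0 - θ • 1) :=
      (Commute.one_left _).smul_left θ
    rw [hsplit, hk, ← pow_mul, add_pow_char_pow_of_commute _ _ hcomm, pow_mul, ← hk, smul_pow,
      one_pow, pow_eq_zero_of_le (lt_card_pow F n).le hn, add_zero]

lemma exists_isExponential [Algebra F K] [IsDedekindDomain A] [IsFractionRing A K]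
    [IsCoefficientRing F A K] [CompleteSpace C] [IsUltrametricDist C] [IsCInfty A K C] :
    ∃ f : E.Lie →ₗ[A] E.Points, E.IsExponential f ∧ Continuous f := by
  obtain ⟨a, θ, hθ, ha⟩ := E.exists_scalar
  obtain ⟨f, e, he, hf, hcont, hadd, hmul⟩ := exists_expSeries F E.coeff a hθ ha fun b x => by
    rw [← twistedEval_mul F (E.coeff_mul a b), ← twistedEval_mul F (E.coeff_mul b a), mul_comm]
  exact ⟨{ toFun := f, map_add' := hadd, map_smul' := hmul }, ⟨e, he, hf⟩, hcont⟩

end Module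

section Main

variable {F A K C : Type*} [Field F] [Fintype F] [CommRing A] [IsDedekindDomain A] [Algebra F A]
  [Field K] [Algebra F K] [Algebra A K] [IsFractionRing A K] [IsCoefficientRing F A K]
  [NormedField C] [CompleteSpace C] [IsUltrametricDist C] [Algebra K C] [Algebra F C]
  [IsCInfty A K C] {L : IntermediateField K C} {d : ℕ} (E : AndersonModule F A L d)

/-- The exponential function `exp_E` (it is the only function with the defining property). -/
noncomputable def exp : E.Lie →ₗ[A] E.Points := E.exists_isExponential.choose

lemma isExponential_exp : E.IsExponential E.exp := E.exists_isExponential.choose_spec.1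

lemma continuous_exp : Continuous E.exp := E.exists_isExponential.choose_spec.2

/-- The period lattice `Λ_E`. -/
noncomputable def periodLattice : Submodule A E.Lie := LinearMap.ker E.exp

end Main

section Special

variable {F A K C : Type*} [Field F] [Fintype F] [CommRing A] [Algebra F A]
  [Field K] [Algebra A K] [NormedField C] [Algebra K C] [Algebra F C]
  {L : IntermediateField K C} {d : ℕ} (E : AndersonModule F A L d)

/-- `E(𝕋) = A ⊗̂ E(ℂ_∞)`; the left `A`-action `a ⊗ 1` is the scalar action `a • ω`. -/
abbrev TPoints : Type _ := CompletedTensor F A E.Points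

/-- `Lie_E(𝕋) = A ⊗̂ Lie_E(ℂ_∞)`; the left `A`-action `a ⊗ 1` is the scalar action `a • y`. -/
abbrev TLie : Type _ := CompletedTensor F A E.Lie

/-- The right `A`-action `1 ⊗ a` on `E(𝕋)`. -/
noncomputable def rightAct (a : A) : E.TPoints →+ E.TPoints :=
  CompletedTensor.map LinearMap.id (E.phi a) (E.continuous_phi a)

/-- The right `A`-action `1 ⊗ ∂ a` on `Lie_E(𝕋)`. -/
noncomputable def rightActLie (a : A) : E.TLie →+ E.TLie :=
  CompletedTensor.map LinearMap.id (E.dphi a) (E.continuous_dphi a)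

/-- The module `𝔰𝔣(E)` of special functions. -/
noncomputable def specialFunctions : Submodule A E.TPoints where
  carrier := {ω | ∀ a : A, a • ω = E.rightAct a ω}
  zero_mem' a := by rw [smul_zero, map_zero]
  add_mem' hx hy a := by rw [smul_add, map_add, hx a, hy a]
  smul_mem' b ω hω a := by
    rw [smul_comm, hω a]
    exact (CompletedTensor.map_id_smul _ (E.continuous_phi a) b ω).symm

/-- The automorphism `∂ r` of `Lie_E(ℂ_∞)` for `r = a / b` in `K`: `∂ r = (∂ b)⁻¹ ∂ a`. -/
noncomputable def dK [IsDomain A] [IsFractionRing A K] (r : K) (x : E.Lie) : E.Lie :=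
  ((E.coeff (IsLocalization.sec A⁰ r).2 0)⁻¹ * E.coeff (IsLocalization.sec A⁰ r).1 0).mulVec x

lemma isUnit_coeff_zero [IsDomain A] [IsFractionRing A K] {b : A} (hb : b ≠ 0) :
    IsUnit (E.coeff b 0) := by
  set θ := algebraMap K C (algebraMap A K b) with hθ
  have h0 : θ ≠ 0 := by
    rw [hθ, Ne, map_eq_zero]
    exact fun h => hb (IsFractionRing.injective A K (by rw [h, map_zero]))
  have hu : IsUnit (θ • (1 : Matrix (Fin d) (Fin d) C)) := isUnit_one.smul (Units.mk0 θ h0)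
  have hc : Commute (E.coeff b 0 - θ • 1) (θ • (1 : Matrix (Fin d) (Fin d) C)) :=
    ((Commute.one_left _).smul_left θ).symm
  have h := (E.isNilpotent b).isUnit_add_right_of_commute hu hc
  rwa [← hθ, sub_add_cancel] at h

lemma smul_dK [IsDomain A] [IsFractionRing A K] {r : K} {a b : A}
    (h : algebraMap A K b * r = algebraMap A K a) (x : E.Lie) : b • E.dK r x = a • x := by
  set n := (IsLocalization.sec A⁰ r).1 with hn
  set m := (IsLocalization.sec A⁰ r).2 with hm
  have hm0 : (m : A) ≠ 0 := nonZeroDivisors.ne_zero m.2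
  have hsec : r * algebraMap A K m = algebraMap A K n := IsLocalization.sec_spec A⁰ r
  have hab : b * n = a * m := by
    apply IsFractionRing.injective A K
    rw [map_mul, map_mul, ← hsec, ← h]; ring
  have hu : IsUnit (E.coeff m 0).det := (Matrix.isUnit_iff_isUnit_det _).1 (E.isUnit_coeff_zero hm0)
  have hmx : (m : A) • E.dK r x = n • x := by
    have key : ∀ y : Fin d → C,
        (E.coeff m 0).mulVec (((E.coeff m 0)⁻¹ * E.coeff n 0).mulVec y) = (E.coeff n 0).mulVec y :=
      fun y => by rw [Matrix.mulVec_mulVec, ← mul_assoc, Matrix.mul_nonsing_inv _ hu, one_mul]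
    exact key x
  have hinj : Function.Injective fun y : E.Lie => (m : A) • y :=
    Matrix.mulVec_injective_of_isUnit (E.isUnit_coeff_zero hm0)
  apply hinj
  change (m : A) • b • E.dK r x = (m : A) • a • x
  rw [smul_comm, hmx, smul_smul, smul_smul, hab, mul_comm]

end Special
end AndersonModule

section Adjoin

variable {F A : Type*} [Field F] [CommRing A] [IsDomain A] [Algebra F A]

/-- The ring `F[u]` is integrally closed: it is a field or a polynomial ring. -/
instance isIntegrallyClosed_adjoin_singleton (u : A) :
    IsIntegrallyClosed (Algebra.adjoin F ({u} : Set A)) := by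
  by_cases hu : IsAlgebraic F u
  · have h : IsField (Algebra.adjoin F ({u} : Set A)) := by
      have : Algebra.IsIntegral F (Algebra.adjoin F ({u} : Set A)) :=
        Algebra.IsIntegral.adjoin (by simpa using hu.isIntegral)
      exact isField_of_isIntegral_of_isField' (Field.toIsField F)
    let := h.toField
    infer_instance
  · have hinj : Function.Injective (Polynomial.aeval (R := F) u) :=
      transcendental_iff_injective.1 hu
    have e := (AlgEquiv.ofInjective _ hinj).trans
      (Subalgebra.equivOfEq _ _ (Algebra.adjoin_singleton_eq_range_aeval F u).symm)
    exact IsIntegrallyClosed.of_equiv e.toRingEquiv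

end Adjoin

/-! ### Gauss–Thakur sums -/

section GaussThakur

variable {A : Type*} [CommRing A]

/-- Multiplicative characters of conductor `𝔭`, with values in the residue field `𝔽_𝔭 = A / 𝔭`. -/
abbrev MultiplicativeCharacter (𝔭 : Ideal A) : Type _ := (A ⧸ 𝔭)ˣ →* (A ⧸ 𝔭)ˣ

namespace MultiplicativeCharacter

variable {𝔭 : Ideal A} (χ : MultiplicativeCharacter 𝔭)

open Classical in
/-- The lift of `χ` to a map `A → 𝔽_𝔭`, which is zero on `𝔭`. -/
noncomputable def lift (a : A) : A ⧸ 𝔭 :=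
  if h : IsUnit (Ideal.Quotient.mk 𝔭 a) then (χ h.unit : A ⧸ 𝔭) else 0

/-- `χ` is evaluative if its lift is a homomorphism of `F`-algebras. -/
def IsEvaluative (F : Type*) [Field F] [Algebra F A] : Prop :=
  ∃ f : A →ₐ[F] A ⧸ 𝔭, ∀ a, f a = χ.lift a

variable {χ}

/-- The lift of an evaluative character as an algebra homomorphism. -/
noncomputable def IsEvaluative.algHom {F : Type*} [Field F] [Algebra F A]
    (h : IsEvaluative χ F) : A →ₐ[F] A ⧸ 𝔭 := h.choose

lemma IsEvaluative.algHom_apply {F : Type*} [Field F] [Algebra F A]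
    (h : IsEvaluative χ F) (a : A) : h.algHom a = χ.lift a := h.choose_spec a

end MultiplicativeCharacter

end GaussThakur

namespace AndersonModule

section GaussSpace

variable {F A K C : Type*} [Field F] [Fintype F] [CommRing A] [Algebra F A]
  [Field K] [Algebra A K] [NormedField C] [Algebra K C] [Algebra F C]
  {L : IntermediateField K C} {d : ℕ} (E : AndersonModule F A L d) {𝔭 : Ideal A}

/-- The Gauss–Thakur sum `g(χ, ψ) = - ∑_{x ∈ (A / 𝔭)ˣ} χ(x)⁻¹ ⊗ ψ(x)` of a multiplicative character
`χ` and an additive character `ψ`, i.e. an `A`-linear map `A / 𝔭 → E(ℂ_∞)` (its values are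
automatically `𝔭`-torsion points). -/
noncomputable def gaussThakurSum (χ : MultiplicativeCharacter 𝔭) (ψ : (A ⧸ 𝔭) →ₗ[A] E.Points) :
    (A ⧸ 𝔭) ⊗[F] E.Points :=
  -∑ᶠ x : (A ⧸ 𝔭)ˣ, (((χ x)⁻¹ : (A ⧸ 𝔭)ˣ) : A ⧸ 𝔭) ⊗ₜ[F] ψ (x : A ⧸ 𝔭)

/-- The space `G(E, χ)` of all `g` in `𝔽_𝔭 ⊗ E(ℂ_∞)` with `(1 ⊗ a) g = (χ(a) ⊗ 1) g`. -/
noncomputable def gaussThakurSpace (χ : MultiplicativeCharacter 𝔭) :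
    AddSubgroup ((A ⧸ 𝔭) ⊗[F] E.Points) where
  carrier := {g | ∀ a : A, (E.phi a).lTensor (A ⧸ 𝔭) g = χ.lift a • g}
  zero_mem' a := by rw [map_zero, smul_zero]
  add_mem' hx hy a := by rw [map_add, smul_add, hx a, hy a]
  neg_mem' hx a := by rw [map_neg, smul_neg, hx a]

lemma phi_comp_phi (a b : A) : E.phi a ∘ₗ E.phi b = E.phi (a * b) :=
  LinearMap.ext fun x => (mul_smul a b x).symm

lemma lTensor_phi_mem {χ : MultiplicativeCharacter 𝔭} (a : A) {g : (A ⧸ 𝔭) ⊗[F] E.Points}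
    (hg : g ∈ E.gaussThakurSpace χ) :
    (E.phi a).lTensor (A ⧸ 𝔭) g ∈ E.gaussThakurSpace χ := by
  intro b
  rw [← LinearMap.comp_apply, ← LinearMap.lTensor_comp, phi_comp_phi, mul_comm, ← phi_comp_phi,
    LinearMap.lTensor_comp, LinearMap.comp_apply, hg b]
  exact ((E.phi a).baseChange (A ⧸ 𝔭)).map_smul (χ.lift b) g

/-- The `A`-module structure of `G(E, χ)`: `a` acts as `1 ⊗ a`. -/
noncomputable instance (χ : MultiplicativeCharacter 𝔭) : Module A (E.gaussThakurSpace χ) where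
  smul a g := ⟨(E.phi a).lTensor (A ⧸ 𝔭) g, E.lTensor_phi_mem a g.2⟩
  one_smul g := Subtype.ext (by
    change (E.phi 1).lTensor (A ⧸ 𝔭) (g : (A ⧸ 𝔭) ⊗[F] E.Points) = g
    have h : E.phi 1 = LinearMap.id := LinearMap.ext fun x => one_smul A x
    rw [h, LinearMap.lTensor_id, LinearMap.id_apply])
  mul_smul a b g := Subtype.ext (by
    change (E.phi (a * b)).lTensor (A ⧸ 𝔭) (g : (A ⧸ 𝔭) ⊗[F] E.Points) =
      (E.phi a).lTensor (A ⧸ 𝔭) ((E.phi b).lTensor (A ⧸ 𝔭) (g : (A ⧸ 𝔭) ⊗[F] E.Points))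
    rw [← phi_comp_phi, LinearMap.lTensor_comp, LinearMap.comp_apply])
  smul_zero a := Subtype.ext (map_zero _)
  smul_add a g h := Subtype.ext (map_add _ _ _)
  add_smul a b g := Subtype.ext (by
    change (E.phi (a + b)).lTensor (A ⧸ 𝔭) (g : (A ⧸ 𝔭) ⊗[F] E.Points) =
      (E.phi a).lTensor (A ⧸ 𝔭) (g : (A ⧸ 𝔭) ⊗[F] E.Points) + (E.phi b).lTensor (A ⧸ 𝔭) g
    have h : E.phi (a + b) = E.phi a + E.phi b := LinearMap.ext fun x => add_smul a b x
    rw [h, LinearMap.lTensor_add, LinearMap.add_apply])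
  zero_smul g := Subtype.ext (by
    change (E.phi 0).lTensor (A ⧸ 𝔭) (g : (A ⧸ 𝔭) ⊗[F] E.Points) = 0
    have h : E.phi 0 = 0 := LinearMap.ext fun x => zero_smul A x
    rw [h, LinearMap.lTensor_zero, LinearMap.zero_apply])

/-- Evaluation `χ ⊗̂ id : E(𝕋) → 𝔽_𝔭 ⊗̂ E(ℂ_∞)`. As `𝔽_𝔭` is finite, the target is the complete
space `𝔽_𝔭 ⊗ E(ℂ_∞)` itself, embedded through `CompletedTensor.ofTensor`. -/
noncomputable def evalAt {χ : MultiplicativeCharacter 𝔭} (hχ : χ.IsEvaluative F) :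
    E.TPoints →+ CompletedTensor F (A ⧸ 𝔭) E.Points :=
  CompletedTensor.map hχ.algHom.toLinearMap LinearMap.id continuous_id

end GaussSpace

section Delta

variable {F A K C : Type*} [Field F] [Fintype F] [CommRing A] [IsDedekindDomain A] [Algebra F A]
  [Field K] [Algebra F K] [Algebra A K] [IsFractionRing A K] [IsCoefficientRing F A K]
  [NormedField C] [CompleteSpace C] [IsUltrametricDist C] [Algebra K C] [Algebra F C]
  [IsCInfty A K C] {L : IntermediateField K C} {d : ℕ} (E : AndersonModule F A L d)

/-- `id ⊗̂ exp_E : Lie_E(𝕋) → E(𝕋)`. -/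
noncomputable def expT : E.TLie →+ E.TPoints :=
  CompletedTensor.map LinearMap.id (E.exp.restrictScalars F) E.continuous_exp

/-- The map `A ⊗_F Λ_E → Lie_E(𝕋)`. -/
noncomputable def latticeToTLie : A ⊗[F] E.periodLattice →+ E.TLie :=
  CompletedTensor.ofTensor.comp
    ((E.periodLattice.subtype.restrictScalars F).lTensor A).toAddMonoidHom

/-- The subring `F[u]` of `A`. -/
abbrev adjoinRing (F : Type*) {A : Type*} [Field F] [CommRing A] [Algebra F A] (u : A) :
    Subalgebra F A := Algebra.adjoin F {u}

/-- The canonical surjection `A ⊗_F Λ_E → A ⊗_{F[u]} Λ_E`. -/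
noncomputable def toTensorAdjoin (u : A) :
    A ⊗[F] E.periodLattice →ₗ[F] A ⊗[adjoinRing F u] E.periodLattice :=
  TensorProduct.lift
    ((TensorProduct.mk (adjoinRing F u) A E.periodLattice).restrictScalars₁₂ F F)

/-- The multiplication map `A ⊗_{F[u]} Λ_E → Λ_E`. -/
noncomputable def mulMap (u : A) :
    A ⊗[adjoinRing F u] E.periodLattice →ₗ[adjoinRing F u] E.periodLattice :=
  TensorProduct.lift
    ((LinearMap.lsmul A E.periodLattice).restrictScalars₁₂ (adjoinRing F u) (adjoinRing F u))

/-- `ω = (id ⊗̂ exp_E)((1 ⊗ ∂ u - u ⊗ 1)⁻¹ x)` for an element `x` of `A ⊗_{F[u]} Λ_E`, where `x` is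
represented by an element of `A ⊗_F Λ_E`, viewed in `Lie_E(𝕋)`. -/
def IsDeltaTilde (u : A) (x : A ⊗[adjoinRing F u] E.periodLattice) (ω : E.TPoints) : Prop :=
  ∃ x' : A ⊗[F] E.periodLattice, E.toTensorAdjoin u x' = x ∧
    ∃ y : E.TLie, E.rightActLie u y - u • y = E.latticeToTLie x' ∧ ω = E.expT y

/-- The domain `𝔡_{A / F[u]} · Λ_E` of `δ_u`. -/
noncomputable def differentLattice (u : A) : Submodule A E.Lie :=
  differentIdeal (adjoinRing F u) A • E.periodLattice

lemma differentLattice_le (u : A) : E.differentLattice u ≤ E.periodLattice :=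
  Submodule.smul_le_right

/-- `δ_u(μ) = ω`: the element `μ` of `𝔡_{A / F[u]} · Λ_E` is the image under multiplication of some
`x` in `A ⊗_{F[u]} Λ_E` on which the two `A`-actions coincide, and `ω` is the image of `x` under
`x ↦ (id ⊗̂ exp_E)((1 ⊗ ∂ u - u ⊗ 1)⁻¹ x)`. -/
def IsDelta (u : A) (μ : E.differentLattice u) (ω : E.TPoints) : Prop :=
  ∃ x : A ⊗[adjoinRing F u] E.periodLattice,
    (∀ a : A, a • x = ((LinearMap.lsmul A E.periodLattice a).restrictScalars
      (adjoinRing F u)).lTensor A x) ∧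
    (E.mulMap u x : E.Lie) = μ ∧ E.IsDeltaTilde u x ω

end Delta

end AndersonModule

/-! The element `u` lies in `𝔭` and is nonzero, hence is not integral over `F`. As `∞` is the only
place off `Spec A`, `u` has its pole there. So `A` is finite over `F[u]`, free because `F[u]` is a
principal ideal ring, and `|u| > 1` in `C`. The congruence `u z ≡ 1` makes `u` a local parameter at
`𝔭`, so `A` is unramified over `F[u]` at `𝔭` and hence generically separable. The trace form is
therefore nondegenerate.

With a basis `b_i` of `A` over `F[u]` and its trace dual `b_i*`, the element `d · ∑ b_i ⊗ b_i*` has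
equal left and right `A`-actions and product `d`. It has coefficients in `A` when `d` is in the
different. Transporting it to `Λ_E` gives the `x` in the definition of `δ_u`
(`TraceTensor.exists_isDiagonal`); it is unique because the discriminant is nonzero and `Λ_E` is
torsion-free (`TraceTensor.eq_zero_of_isDiagonal`).

The operator `1 ⊗ ∂u - u ⊗ 1` is invertible on `Lie_E(𝕋)`: some power of `∂u` is a scalar of norm `>
1`, whereas `u ⊗ 1` does not increase norms, so a Neumann argument applies
(`bijective_rightActLie_sub_smul`). Changing the representative of `x` changes the resolvent by an
element of `A ⊗ Λ_E`, which `exp_E` kills (`deltaLift_mul_tmul`).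

The comparison has two halves. Evaluation at `χ` kills `u ⊗ 1`, so the resolvent becomes `(∂u)⁻¹`;
since `u z ≡ 1 mod 𝔭`, on `G(E, χ)` this amounts to `∂z`, and `δ_u(μ)(𝔓)` equals `(χ ⊗ exp_E ∂z)(x)`
(`eq_map_expDK_of_evalAt`). The operator `-∑_v χ(v)⁻¹ ⊗ φ_v` then fixes this value, because each
summand does and the number of units of `𝔽_𝔭` is `-1` in `𝔽_𝔭`. On a pure tensor `a ⊗ λ` the same
operator produces `χ(a) g(χ, ψ_λ) = g(χ, ψ_{aλ})`, so on `x` it produces the Gauss–Thakur sum of the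
product `μ` (`map_expDK_eq_gaussThakurSum`). -/

namespace TraceTensor

/-! ### Diagonal tensors, the trace form and the different -/

section Contract

variable {R A M ι : Type*} [CommRing R] [CommRing A] [Algebra R A] [AddCommGroup M] [Module R M]
  [Fintype ι] (b : Module.Basis ι R A)

/-- Contraction of the first factor with a linear functional. -/
noncomputable def contract (f : A →ₗ[R] R) : A ⊗[R] M →ₗ[R] M :=
  (TensorProduct.lid R M).toLinearMap ∘ₗ f.rTensor M

@[simp] lemma contract_tmul (f : A →ₗ[R] R) (a : A) (m : M) :
    contract f (a ⊗ₜ[R] m) = f a • m := by simp [contract]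

lemma sum_basis_tmul_contract (x : A ⊗[R] M) :
    ∑ i, b i ⊗ₜ[R] contract (b.coord i) x = x := by
  induction x using TensorProduct.induction_on with
  | zero => simp
  | tmul a m =>
    simp only [contract_tmul, ← TensorProduct.smul_tmul, ← TensorProduct.sum_tmul]
    congr 1
    exact b.sum_repr a
  | add x y hx hy => simp only [map_add, TensorProduct.tmul_add, Finset.sum_add_distrib, hx, hy]

/-- The trace of multiplication by `a` is the sum of the diagonal coefficients, the `i`-th
coordinates of `a * b i`. Moving `b i` onto the tensor prepares the use of diagonality. -/
lemma contract_trace (x : A ⊗[R] M) :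
    contract (Algebra.trace R A) x = ∑ i, contract (b.coord i) (b i • x) := by
  classical
  induction x using TensorProduct.induction_on with
  | zero => simp
  | tmul a m =>
    simp only [TensorProduct.smul_tmul', contract_tmul, ← Finset.sum_smul, smul_eq_mul]
    congr 1
    rw [Algebra.trace_eq_matrix_trace b, Matrix.trace]
    refine Finset.sum_congr rfl fun i _ => ?_
    rw [Matrix.diag_apply, Algebra.leftMulMatrix_eq_repr_mul, mul_comm]
    rfl
  | add x y hx hy => simp [smul_add, hx, hy, Finset.sum_add_distrib]

end Contract

section Coord

variable {R A M ι : Type*} [CommRing R] [CommRing A] [Algebra R A] [AddCommGroup M] [Module R M]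
  [Module A M] [IsScalarTower R A M] [Fintype ι] (b : Module.Basis ι R A)

/-- The two `A`-module structures of `A ⊗[R] M` coincide on `x`. -/
def IsDiagonal (x : A ⊗[R] M) : Prop :=
  ∀ a : A, a • x = ((LinearMap.lsmul A M a).restrictScalars R).lTensor A x

/-- The multiplication map `A ⊗[R] M → M`. -/
noncomputable def mul : A ⊗[R] M →ₗ[R] M :=
  TensorProduct.lift ((LinearMap.lsmul A M).restrictScalars₁₂ R R)

@[simp] lemma mul_tmul (a : A) (m : M) : mul (R := R) (a ⊗ₜ[R] m) = a • m := rfl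

lemma mul_smul (a : A) (x : A ⊗[R] M) : mul (a • x) = a • mul x := by
  induction x using TensorProduct.induction_on with
  | zero => simp
  | tmul c m => simp [TensorProduct.smul_tmul', smul_smul]
  | add x y hx hy => simp [smul_add, hx, hy]

lemma IsDiagonal.add {x y : A ⊗[R] M} (hx : IsDiagonal x) (hy : IsDiagonal y) :
    IsDiagonal (x + y) := fun a => by rw [smul_add, map_add, hx a, hy a]

lemma IsDiagonal.zero : IsDiagonal (0 : A ⊗[R] M) := fun a => by rw [smul_zero, map_zero]

lemma IsDiagonal.sub {x y : A ⊗[R] M} (hx : IsDiagonal x) (hy : IsDiagonal y) :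
    IsDiagonal (x - y) := fun a => by rw [smul_sub, map_sub, hx a, hy a]

lemma lTensor_lsmul_smul (a c : A) (x : A ⊗[R] M) :
    ((LinearMap.lsmul A M a).restrictScalars R).lTensor A (c • x) =
      c • ((LinearMap.lsmul A M a).restrictScalars R).lTensor A x := by
  induction x using TensorProduct.induction_on with
  | zero => simp
  | tmul c m => simp [TensorProduct.smul_tmul']
  | add x y hx hy => simp [smul_add, hx, hy]

lemma IsDiagonal.smul {x : A ⊗[R] M} (hx : IsDiagonal x) (c : A) : IsDiagonal (c • x) := fun a => by
  rw [lTensor_lsmul_smul, ← hx a, smul_comm]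

lemma contract_lTensor_lsmul (f : A →ₗ[R] R) (a : A) (x : A ⊗[R] M) :
    contract f (((LinearMap.lsmul A M a).restrictScalars R).lTensor A x) = a • contract f x := by
  induction x using TensorProduct.induction_on with
  | zero => simp
  | tmul c m => simp [smul_comm a (f c) m]
  | add x y hx hy => simp [smul_add, hx, hy]

/-- In `contract_trace` diagonality moves each `b i` to the second factor, which turns the sum into
the product of the basis expansion of `x`. Products of diagonal tensors thus become trace
computations. -/
lemma contract_trace_of_isDiagonal (b : Module.Basis ι R A) {x : A ⊗[R] M} (hx : IsDiagonal x) :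
    contract (Algebra.trace R A) x = mul x := by
  conv_rhs => rw [← sum_basis_tmul_contract b x, map_sum]
  rw [contract_trace b]
  refine Finset.sum_congr rfl fun i _ => ?_
  rw [hx, contract_lTensor_lsmul, mul_tmul]

/-- Every `b i • x` is diagonal with product zero, so its trace contraction vanishes. This is a
homogeneous linear system for the coordinates of `x`, with the trace matrix as its matrix. -/
lemma eq_zero_of_isDiagonal [DecidableEq ι] (hdisc : Algebra.discr R b ≠ 0)
    (htf : ∀ (r : R) (m : M), r ≠ 0 → r • m = 0 → m = 0)
    {x : A ⊗[R] M} (hx : IsDiagonal x) (h0 : mul x = 0) : x = 0 := by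
  set l : ι → M := fun i => contract (b.coord i) x with hl
  have hT : ∀ i, ∑ j, Algebra.traceMatrix R b i j • l j = 0 := by
    intro i
    have h1 := contract_trace_of_isDiagonal b (hx.smul (b i))
    rw [mul_smul, h0, smul_zero, ← sum_basis_tmul_contract b x, Finset.smul_sum, map_sum] at h1
    rw [← h1]
    refine Finset.sum_congr rfl fun j _ => ?_
    rw [TensorProduct.smul_tmul', contract_tmul]
    rfl
  -- Cramer's rule: the adjugate of the trace matrix turns the system into `discr • l k = 0`, and
  -- `M` has no torsion.
  have hl0 : ∀ k, l k = 0 := by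
    intro k
    refine htf _ _ hdisc ?_
    rw [Algebra.discr_def]
    have h2 : ∑ i, (Algebra.traceMatrix R b).adjugate k i • ∑ j, Algebra.traceMatrix R b i j • l j
        = 0 := Finset.sum_eq_zero fun i _ => by rw [hT, smul_zero]
    simp only [Finset.smul_sum, smul_smul] at h2
    rw [Finset.sum_comm] at h2
    simp only [← Finset.sum_smul] at h2
    rw [← h2, Finset.sum_eq_single k]
    · rw [← Matrix.mul_apply, Matrix.adjugate_mul]; simp
    · intro j _ hj
      rw [← Matrix.mul_apply, Matrix.adjugate_mul]; simp [hj.symm]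
    · simp
  rw [← sum_basis_tmul_contract b x]
  exact Finset.sum_eq_zero fun i _ => by
    change b i ⊗ₜ[R] l i = 0
    rw [hl0, TensorProduct.tmul_zero]

end Coord

section Different

attribute [local instance] FractionRing.liftAlgebra FractionRing.isScalarTower_liftAlgebra

variable {R A : Type*} [CommRing R] [IsDomain R] [IsIntegrallyClosed R] [CommRing A]
  [IsDedekindDomain A] [Algebra R A] [Module.IsTorsionFree R A] [Module.Finite R A] [Module.Free R A]
  [Algebra.IsSeparable (FractionRing R) (FractionRing A)]

/-- The discriminant can be computed over the fraction fields, where separability makes the trace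
form nondegenerate. -/
lemma discr_ne_zero {ι : Type*} [Fintype ι] [DecidableEq ι] (b : Module.Basis ι R A) :
    Algebra.discr R b ≠ 0 := by
  have h := Algebra.discr_not_zero_of_basis (FractionRing R)
    (b.localizationLocalization (FractionRing R) R⁰ (FractionRing A))
  rw [Algebra.discr_localizationLocalization] at h
  intro h0
  rw [h0, map_zero] at h
  exact h rfl

/-- The witness is the Casimir element `∑ b i ⊗ d * bd i` of the trace form. The dual basis `bd`
lives only in the fraction field; multiplication by an element of the different brings it back into
`A`. -/
lemma exists_isDiagonal {d : A} (hd : d ∈ differentIdeal R A) :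
    ∃ x : A ⊗[R] A, IsDiagonal x ∧ mul x = d := by
  classical
  let b := Module.Free.chooseBasis R A
  let k := FractionRing R
  let L := FractionRing A
  let bL := b.localizationLocalization k R⁰ L
  let bd := bL.traceDual
  have hb : ∀ i, bL i = algebraMap A L (b i) := fun i => by simp [bL]
  have hrepr : ∀ (a : A) (j), algebraMap R k (b.repr a j) =
      Algebra.trace k L (algebraMap A L a * bd j) := by
    intro a j
    have h : bd.traceDual.repr (algebraMap A L a) j = _ := bd.traceDual_repr_apply _ j
    rw [Module.Basis.traceDual_traceDual, Module.Basis.localizationLocalization_repr_algebraMap,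
      Algebra.traceForm_apply] at h
    exact h
  have h1 : ∀ i, ∃ c : A, algebraMap A L c = algebraMap A L d * bd i := by
    intro i
    -- By definition the different consists of the elements of `A` that multiply the trace dual of
    -- `A` into `A`.
    have hd' : algebraMap A L d ∈ (1 / Submodule.traceDual R k 1 : Submodule A L) := hd
    rw [Submodule.mem_div_iff_forall_mul_mem] at hd'
    have h := hd' (bd i) (Submodule.mem_traceDual.2 fun y hy => by
      obtain ⟨a, rfl⟩ := Submodule.mem_one.1 hy
      exact ⟨b.repr a i, by rw [hrepr, Algebra.traceForm_apply, mul_comm]⟩)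
    exact Submodule.mem_one.1 h
  choose c hc using h1
  have hexp : ∀ y : L, ∑ i, Algebra.trace k L (y * bL i) • bd i = y := by
    intro y
    conv_rhs => rw [← bd.sum_repr y]
    refine Finset.sum_congr rfl fun i _ => ?_
    rw [bL.traceDual_repr_apply, Algebra.traceForm_apply]
  have hinj : Function.Injective (algebraMap A L) := IsFractionRing.injective A L
  have hmap : ∀ (r : R) (i), algebraMap A L (r • c i) =
      algebraMap A L d * (algebraMap R k r • bd i) := by
    intro r i
    rw [Algebra.smul_def, map_mul, hc, ← IsScalarTower.algebraMap_apply R A L, Algebra.smul_def,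
      ← IsScalarTower.algebraMap_apply R k L]
    ring
  -- The matrix of multiplication by `a` in the basis `b` has entries `Tr(a * b i * bd j)`. Read in
  -- the other index, the same entries expand `a * bd j` in the dual basis, so `a` passes from the
  -- left factor to the right.
  have hdiag : IsDiagonal (∑ i, b i ⊗ₜ[R] c i) := by
    intro a
    have hsum : ∀ j, ∑ i, b.repr (a * b i) j • c i = a * c j := by
      intro j
      apply hinj
      rw [map_sum, map_mul, hc, mul_left_comm, ← hexp (algebraMap A L a * bd j), Finset.mul_sum]
      refine Finset.sum_congr rfl fun i _ => ?_
      rw [hmap, hrepr, map_mul (algebraMap A L), hb, mul_right_comm]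
    have hexpand : ∀ i, a • b i = ∑ j, b.repr (a * b i) j • b j := fun i => (b.sum_repr _).symm
    rw [Finset.smul_sum, map_sum]
    simp only [TensorProduct.smul_tmul', hexpand, TensorProduct.sum_tmul, TensorProduct.smul_tmul]
    rw [Finset.sum_comm]
    refine Finset.sum_congr rfl fun j _ => ?_
    rw [← TensorProduct.tmul_sum, hsum]
    rfl
  refine ⟨_, hdiag, ?_⟩
  -- The product is computed as `∑ Tr(b i) • c i`, which is `d` times the dual-basis expansion of
  -- `1`.
  rw [← contract_trace_of_isDiagonal b hdiag, map_sum]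
  apply hinj
  rw [map_sum]
  conv_rhs => rw [← mul_one (algebraMap A L d), ← hexp 1, Finset.mul_sum]
  refine Finset.sum_congr rfl fun i _ => ?_
  rw [contract_tmul, hmap, one_mul, hb, Algebra.trace_localization R R⁰]

end Different

end TraceTensor

/-! ### Finiteness and generic separability of `A` over `F[u]` -/

section Uniformizer

variable {F A : Type*} [Field F] [CommRing A] [IsDedekindDomain A] [Algebra F A]

lemma not_isIntegral_of_mem {𝔭 : Ideal A} (h𝔭 : 𝔭 ≠ ⊤) {u : A} (hu : u ∈ 𝔭) (hu0 : u ≠ 0) :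
    ¬ IsIntegral F u := fun h => h𝔭 (Ideal.eq_top_of_isUnit_mem _ hu (h.isUnit hu0))

/-- `F[u]` is a quotient of `F[X]`. A finite torsion-free module over it is therefore free, which
supplies the bases needed for trace duality. -/
instance isPrincipalIdealRing_adjoin_singleton (u : A) :
    IsPrincipalIdealRing (Algebra.adjoin F ({u} : Set A)) := by
  have e := Subalgebra.equivOfEq _ _ (Algebra.adjoin_singleton_eq_range_aeval F u)
  have hs : Function.Surjective ((e.symm : _ →ₐ[F] Algebra.adjoin F ({u} : Set A)).comp
      (Polynomial.aeval (R := F) u).rangeRestrict) :=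
    e.symm.surjective.comp (AlgHom.rangeRestrict_surjective _)
  exact IsPrincipalIdealRing.of_surjective _ hs

variable (F) in
-- An integrally closed subring of `K` is an intersection of valuation rings, so some valuation ring
-- omits `u`. A valuation ring not containing `A` can only be the one at `∞`.
lemma algebraMap_notMem_place (K : Type*) [Field K] [Algebra F K] [Algebra A K]
    [IsScalarTower F A K] [IsFractionRing A K] [IsCoefficientRing F A K]
    {u : A} (hu : ¬ IsIntegral F u) (W : ValuationSubring K) (hW : ∃ a : A, algebraMap A K a ∉ W) :
    algebraMap A K u ∉ W := by
  have hu' : algebraMap A K u ∉ (integralClosure F K).toSubring := fun h =>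
    hu ((isIntegral_algebraMap_iff (IsFractionRing.injective A K)).1 h)
  have : IsIntegrallyClosedIn (integralClosure F K).toSubring K :=
    inferInstanceAs (IsIntegrallyClosedIn (integralClosure F K) K)
  obtain ⟨V, -, hV⟩ := Subring.exists_le_valuationSubring_of_isIntegrallyClosedIn hu'
  rwa [(IsCoefficientRing.existsUnique_place (F := F) (A := A) (K := K)).unique hW ⟨u, hV⟩]

variable (F) in
-- If `a` were not integral over `F[u]`, a valuation ring containing `F[u]` would omit `a`. It would
-- be the place `∞`, where `u` has a pole: a contradiction.
lemma isIntegral_adjoin_singleton (K : Type*) [Field K] [Algebra F K] [Algebra A K]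
    [IsScalarTower F A K] [IsFractionRing A K] [IsCoefficientRing F A K]
    {u : A} (hu : ¬ IsIntegral F u) : Algebra.IsIntegral (Algebra.adjoin F ({u} : Set A)) A := by
  refine ⟨fun a => ?_⟩
  rw [← isIntegral_algebraMap_iff (IsFractionRing.injective A K)]
  by_contra ha
  have ha' : algebraMap A K a ∉ (integralClosure (Algebra.adjoin F ({u} : Set A)) K).toSubring := ha
  have : IsIntegrallyClosedIn
      (integralClosure (Algebra.adjoin F ({u} : Set A)) K).toSubring K :=
    inferInstanceAs (IsIntegrallyClosedIn (integralClosure (Algebra.adjoin F ({u} : Set A)) K) K)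
  obtain ⟨V, hRV, hV⟩ := Subring.exists_le_valuationSubring_of_isIntegrallyClosedIn ha'
  refine algebraMap_notMem_place F K hu V ⟨a, hV⟩ (hRV ?_)
  exact isIntegral_algebraMap (R := Algebra.adjoin F ({u} : Set A))
    (x := ⟨u, Algebra.self_mem_adjoin_singleton F u⟩)

variable (F) in
lemma finite_adjoin_singleton (K : Type*) [Field K] [Algebra F K] [Algebra A K]
    [IsScalarTower F A K] [IsFractionRing A K] [IsCoefficientRing F A K]
    {u : A} (hu : ¬ IsIntegral F u) : Module.Finite (Algebra.adjoin F ({u} : Set A)) A := by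
  have := isIntegral_adjoin_singleton F K hu
  have : Algebra.FiniteType F A := IsCoefficientRing.finiteType K
  have : Algebra.FiniteType (Algebra.adjoin F ({u} : Set A)) A :=
    Algebra.FiniteType.of_restrictScalars_finiteType F _ A
  exact Algebra.IsIntegral.finite

lemma finite_quotient [Finite F] [Algebra.FiniteType F A] (𝔭 : Ideal A) [𝔭.IsMaximal] :
    Finite (A ⧸ 𝔭) := by
  let := Ideal.Quotient.field 𝔭
  have : Algebra.FiniteType F (A ⧸ 𝔭) := inferInstance
  have : Module.Finite F (A ⧸ 𝔭) := finite_of_finite_type_of_isJacobsonRing F (A ⧸ 𝔭)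
  exact Module.finite_of_finite F

lemma isSeparable_of_finite (k l : Type*) [Field k] [Field l] [Algebra k l] [Finite k] [Finite l] :
    Algebra.IsSeparable k l := by
  have : Module.Finite k l := Module.Finite.of_finite
  have : PerfectField k := PerfectField.ofFinite
  exact Algebra.IsAlgebraic.isSeparable_of_perfectField

attribute [local instance] FractionRing.liftAlgebra FractionRing.isScalarTower_liftAlgebra

/-- An extension unramified at some prime is separable at the generic point. -/
lemma isSeparable_fractionRing_of_mem (R : Type*) {A : Type*} [CommRing R] [IsDomain R] [CommRing A]
    [IsDomain A] [Algebra R A] [Module.IsTorsionFree R A] [Module.Finite R A]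
    (𝔭 : Ideal A) [𝔭.IsMaximal] [Finite (A ⧸ 𝔭)]
    {u : R} (hu : algebraMap R A u ∈ 𝔭)
    {e : A} (he : e ∉ 𝔭) (he2 : ∀ x ∈ 𝔭, ∃ y, e * x = algebraMap R A u * y) :
    Algebra.IsSeparable (FractionRing R) (FractionRing A) := by
  let p : Ideal R := 𝔭.under R
  let := Localization.AtPrime.algebraOfLiesOver p 𝔭
  -- The residue extension is one of finite fields, hence separable. As `e` is a unit in the
  -- localization at `𝔭`, the relation `e * x = u * y` shows that `u` generates the maximal ideal
  -- there.
  have h : Algebra.IsUnramifiedAt R 𝔭 := by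
    rw [Algebra.isUnramifiedAt_iff_map_eq R p 𝔭]
    constructor
    · have h1 : Finite 𝔭.ResidueField :=
        Finite.of_surjective _ (Ideal.bijective_algebraMap_quotient_residueField 𝔭).2
      have h2 : Finite p.ResidueField :=
        Finite.of_injective _ (algebraMap p.ResidueField 𝔭.ResidueField).injective
      exact isSeparable_of_finite _ _
    · rw [← Localization.AtPrime.map_eq_maximalIdeal]
      apply le_antisymm
      · rw [Ideal.map_le_iff_le_comap]
        intro r hr
        rw [Ideal.mem_comap, IsScalarTower.algebraMap_apply R A]
        exact Ideal.mem_map_of_mem _ hr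
      · rw [Ideal.map_le_iff_le_comap]
        intro x hx
        obtain ⟨y, hy⟩ := he2 x hx
        rw [Ideal.mem_comap]
        have hunit : IsUnit (algebraMap A (Localization.AtPrime 𝔭) e) :=
          IsLocalization.map_units (M := 𝔭.primeCompl) _ ⟨e, he⟩
        rw [← Ideal.unit_mul_mem_iff_mem _ hunit, ← map_mul, hy, map_mul]
        refine Ideal.mul_mem_right _ _ ?_
        rw [← IsScalarTower.algebraMap_apply R A (Localization.AtPrime 𝔭)]
        have hup : u ∈ p := hu
        exact Ideal.mem_map_of_mem (algebraMap R (Localization.AtPrime 𝔭)) hup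
  -- The fraction field is a further localization of `A` at `𝔭`, so it stays formally unramified
  -- over `R`; for the extension of fraction fields this is separability.
  have hle : 𝔭.primeCompl ≤ A⁰ := 𝔭.primeCompl_le_nonZeroDivisors
  let : Algebra (Localization.AtPrime 𝔭) (FractionRing A) :=
    IsLocalization.localizationAlgebraOfSubmonoidLe _ _ 𝔭.primeCompl A⁰ hle
  have hT : IsScalarTower A (Localization.AtPrime 𝔭) (FractionRing A) :=
    IsLocalization.localization_isScalarTower_of_submonoid_le _ _ 𝔭.primeCompl A⁰ hle
  have : IsScalarTower R (Localization.AtPrime 𝔭) (FractionRing A) := .of_algebraMap_eq fun x => by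
      rw [IsScalarTower.algebraMap_apply R A (FractionRing A),
        IsScalarTower.algebraMap_apply R A (Localization.AtPrime 𝔭), hT.algebraMap_apply]
  have : IsFractionRing (Localization.AtPrime 𝔭) (FractionRing A) :=
    IsFractionRing.isFractionRing_of_isDomain_of_isLocalization 𝔭.primeCompl _ _
  have : Algebra.FormallyUnramified R (Localization.AtPrime 𝔭) := h
  have : Algebra.FormallyUnramified (Localization.AtPrime 𝔭) (FractionRing A) :=
    .of_isLocalization (Localization.AtPrime 𝔭)⁰
  have : Algebra.FormallyUnramified R (FractionRing A) := .comp R (Localization.AtPrime 𝔭) _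
  have : Algebra.FormallyUnramified (FractionRing R) (FractionRing A) := .of_restrictScalars R _ _
  exact (Algebra.FormallyUnramified.iff_isSeparable _ _).1 this

end Uniformizer

/-! ### Completed tensor products -/

section Norms

variable {F : Type*} [Field F] {B B' B'' V W X : Type*} [CommRing B] [Algebra F B] [CommRing B']
  [Algebra F B'] [CommRing B''] [Algebra F B'']
  [SeminormedAddCommGroup V] [Module F V] [SeminormedAddCommGroup W] [Module F W]
  [SeminormedAddCommGroup X] [Module F X]

namespace GaussTensor

lemma IsRepBound.map {x : B ⊗[F] V} {s : ℝ} (hx : IsRepBound x s) (f : B →ₗ[F] B')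
    (g : V →ₗ[F] W) {r : ℝ} (hr : 0 ≤ r) (hg : ∀ v, ‖g v‖ ≤ r * ‖v‖) :
    IsRepBound (TensorProduct.map f g x) (r * s) := by
  obtain ⟨hs, n, b, v, rfl, hv⟩ := hx
  refine ⟨mul_nonneg hr hs, n, fun i => f (b i), fun i => g (v i), by simp, fun i => ?_⟩
  exact (hg _).trans (mul_le_mul_of_nonneg_left (hv i) hr)

lemma le_mul_gaussNorm {x : B ⊗[F] V} {t r : ℝ} (hr : 0 ≤ r)
    (h : ∀ s, IsRepBound x s → t ≤ r * s) : t ≤ r * gaussNorm x := by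
  refine le_of_forall_pos_le_add fun ε hε => ?_
  -- The infimum need not be attained, hence the slack `ε`. The denominator is `r + 1` because `r`
  -- may be zero.
  obtain ⟨s, hs, hxs⟩ := exists_isRepBound_lt (x := x)
    (lt_add_of_pos_right _ (div_pos hε (by positivity : 0 < r + 1)))
  refine (h s hxs).trans ((mul_le_mul_of_nonneg_left hs.le hr).trans ?_)
  rw [mul_add]
  gcongr
  rw [mul_div_assoc', div_le_iff₀ (by positivity)]
  nlinarith

lemma norm_map_le (f : B →ₗ[F] B') (g : V →ₗ[F] W) {r : ℝ} (hr : 0 ≤ r)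
    (hg : ∀ v, ‖g v‖ ≤ r * ‖v‖) (x : GaussTensor F B V) : ‖map f g x‖ ≤ r * ‖x‖ :=
  le_mul_gaussNorm hr fun _ hs => gaussNorm_le (hs.map f g hr hg)

end GaussTensor

namespace CompletedTensor

lemma norm_ofTensor (x : B ⊗[F] V) :
    ‖(ofTensor x : CompletedTensor F B V)‖ = GaussTensor.gaussNorm x :=
  UniformSpace.Completion.norm_coe (E := GaussTensor F B V) x

lemma isClosed_induction {p : CompletedTensor F B V → Prop} (hp : IsClosed {x | p x})
    (h : ∀ x : B ⊗[F] V, p (ofTensor x)) (x : CompletedTensor F B V) : p x :=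
  UniformSpace.Completion.induction_on x hp h

lemma smul_ofTensor (b : B) (x : B ⊗[F] V) :
    b • (ofTensor x : CompletedTensor F B V) = ofTensor (b • x) :=
  (UniformSpace.Completion.coe_smul (M := B) (X := GaussTensor F B V) b x).symm

lemma norm_map_le (f : B →ₗ[F] B') (g : V →ₗ[F] W) (hgc : Continuous g) {r : ℝ} (hr : 0 ≤ r)
    (hg : ∀ v, ‖g v‖ ≤ r * ‖v‖) (x : CompletedTensor F B V) : ‖map f g hgc x‖ ≤ r * ‖x‖ := by
  induction x using isClosed_induction with
  | hp =>
    exact isClosed_le (continuous_map f g hgc).norm (continuous_const.mul continuous_norm)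
  | h x =>
    rw [map_ofTensor, norm_ofTensor, norm_ofTensor]
    exact GaussTensor.norm_map_le f g hr hg x

lemma map_map (f : B →ₗ[F] B') (g : V →ₗ[F] W) (hg : Continuous g) (f' : B' →ₗ[F] B'')
    (g' : W →ₗ[F] X) (hg' : Continuous g') (h : Continuous (g' ∘ₗ g)) (x : CompletedTensor F B V) :
    map f' g' hg' (map f g hg x) = map (f' ∘ₗ f) (g' ∘ₗ g) h x := by
  induction x using isClosed_induction with
  | hp =>
    exact isClosed_eq ((continuous_map _ _ _).comp (continuous_map _ _ _)) (continuous_map _ _ _)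
  | h x => simp only [map_ofTensor, TensorProduct.map_comp, LinearMap.comp_apply]

/-- Commutative squares survive completion. This is what lets evaluation at `χ`, the exponential and
the right `A`-action be interchanged. -/
lemma map_map_eq_map_map {B₂ W₂ : Type*} [CommRing B₂] [Algebra F B₂] [SeminormedAddCommGroup W₂]
    [Module F W₂] {f : B →ₗ[F] B'} {g : V →ₗ[F] W} (hg : Continuous g) {f' : B' →ₗ[F] B''}
    {g' : W →ₗ[F] X} (hg' : Continuous g') {f₂ : B →ₗ[F] B₂} {g₂ : V →ₗ[F] W₂}
    (hg₂ : Continuous g₂) {f₂' : B₂ →ₗ[F] B''} {g₂' : W₂ →ₗ[F] X} (hg₂' : Continuous g₂')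
    (hf : f' ∘ₗ f = f₂' ∘ₗ f₂) (h : g' ∘ₗ g = g₂' ∘ₗ g₂) (x : CompletedTensor F B V) :
    map f' g' hg' (map f g hg x) = map f₂' g₂' hg₂' (map f₂ g₂ hg₂ x) := by
  rw [map_map _ _ _ _ _ _ (hg'.comp hg), map_map _ _ _ _ _ _ (hg₂'.comp hg₂)]
  simp only [hf, h]

lemma map_id_id (x : CompletedTensor F B V) :
    map (LinearMap.id : B →ₗ[F] B) (LinearMap.id : V →ₗ[F] V) continuous_id x = x := by
  induction x using isClosed_induction with
  | hp => exact isClosed_eq (continuous_map _ _ _) continuous_id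
  | h x => rw [map_ofTensor, TensorProduct.map_id, LinearMap.id_apply]

lemma map_id_map_id_of_comp_eq_id (g : V →ₗ[F] W) (hg : Continuous g) (g' : W →ₗ[F] V)
    (hg' : Continuous g') (h : g' ∘ₗ g = LinearMap.id) (x : CompletedTensor F B V) :
    map (LinearMap.id : B →ₗ[F] B) g' hg' (map LinearMap.id g hg x) = x := by
  rw [map_map _ _ _ _ _ _ (hg'.comp hg)]
  simp only [h, LinearMap.comp_id]
  exact map_id_id x

lemma map_algHom_smul (f : B →ₐ[F] B') (g : V →ₗ[F] W) (hg : Continuous g) (b : B)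
    (x : CompletedTensor F B V) :
    map f.toLinearMap g hg (b • x) = f b • map f.toLinearMap g hg x := by
  induction x using isClosed_induction with
  | hp =>
    exact isClosed_eq ((continuous_map _ _ _).comp (continuous_const_smul b))
      (Continuous.const_smul (continuous_map f.toLinearMap g hg) (f b))
  | h x =>
    rw [smul_ofTensor, map_ofTensor, map_ofTensor, smul_ofTensor]
    congr 1
    induction x using TensorProduct.induction_on with
    | zero => simp
    | tmul c v => simp [TensorProduct.smul_tmul']
    | add x y hx hy => rw [smul_add, map_add, map_add, hx, hy, smul_add]

lemma norm_smul_le_self (b : B) (x : CompletedTensor F B V) : ‖b • x‖ ≤ ‖x‖ := by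
  induction x using isClosed_induction with
  | hp => exact isClosed_le (continuous_const_smul b).norm continuous_norm
  | h x =>
    rw [smul_ofTensor, norm_ofTensor, norm_ofTensor]
    have h := GaussTensor.norm_map_le (LinearMap.mulLeft F b) (LinearMap.id : V →ₗ[F] V)
      zero_le_one (fun v => by simp) x
    rw [one_mul] at h
    have h2 : TensorProduct.map (LinearMap.mulLeft F b) (LinearMap.id : V →ₗ[F] V) x = b • x := by
      clear h
      induction x using TensorProduct.induction_on with
      | zero => simp
      | tmul c v => simp [TensorProduct.smul_tmul']
      | add x y hx hy => rw [map_add, smul_add, hx, hy]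
    rw [← h2]
    exact h

end CompletedTensor

end Norms

/-! ### Finite-dimensional first factors: the tensor product is already complete -/

section FiniteDimensional

variable {F : Type*} [Field F] {B V : Type*} [CommRing B] [Algebra F B]
  [NormedAddCommGroup V] [Module F V]

/-- Contraction of the first factor with a linear functional, on the Gauss normed tensor product. -/
noncomputable def GaussTensor.contract (f : B →ₗ[F] F) : GaussTensor F B V →+ V :=
  (TraceTensor.contract f : B ⊗[F] V →ₗ[F] V).toAddMonoidHom

lemma GaussTensor.contract_apply (f : B →ₗ[F] F) (x : B ⊗[F] V) :
    GaussTensor.contract f x = TraceTensor.contract f x := rfl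

variable [IsUltrametricDist V] (hV : ∀ (c : F) (v : V), ‖c • v‖ ≤ ‖v‖)

include hV in
-- The constant is `1` for every `f`: scalars of `F` do not increase norms, and the ultrametric
-- inequality bounds a sum by its largest term, whatever the representation.
lemma GaussTensor.norm_contract_le (f : B →ₗ[F] F) (x : GaussTensor F B V) :
    ‖GaussTensor.contract f x‖ ≤ ‖x‖ := by
  rw [← one_mul ‖x‖]
  refine le_mul_gaussNorm (B := B) (V := V) (F := F) zero_le_one fun s hs => ?_
  obtain ⟨hs0, n, b, v, rfl, hv⟩ := hs
  have h : GaussTensor.contract f (∑ i, b i ⊗ₜ[F] v i : B ⊗[F] V) = ∑ i, f (b i) • v i := by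
    rw [GaussTensor.contract_apply, map_sum]
    exact Finset.sum_congr rfl fun i _ => TraceTensor.contract_tmul f (b i) (v i)
  rw [h, one_mul]
  exact IsUltrametricDist.norm_sum_le_of_forall_le_of_nonneg hs0 fun i _ => (hV _ _).trans (hv i)

include hV in
lemma GaussTensor.continuous_contract (f : B →ₗ[F] F) :
    Continuous (GaussTensor.contract (V := V) f) :=
  AddMonoidHomClass.continuous_of_bound (GaussTensor.contract f) 1 fun x => by
    rw [one_mul]; exact GaussTensor.norm_contract_le hV f x

lemma CompletedTensor.continuous_tmul (b : B) :
    Continuous fun v : V => (ofTensor (b ⊗ₜ[F] v) : CompletedTensor F B V) := by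
  refine AddMonoidHomClass.continuous_of_bound
    ((ofTensor : B ⊗[F] V →+ CompletedTensor F B V).comp
      (TensorProduct.mk F B V b).toAddMonoidHom) 1 fun v => ?_
  rw [one_mul]
  refine (norm_ofTensor _).trans_le (GaussTensor.gaussNorm_le ?_)
  exact ⟨norm_nonneg _, 1, fun _ => b, fun _ => v, by simp, fun _ => le_rfl⟩

variable [CompleteSpace V] [Module.Finite F B]

include hV in
-- A basis of `B` identifies `B ⊗ V` with a finite power of the complete space `V`. Its coordinates
-- are contractions, continuous for the Gauss norm: they detect zero, and their extensions to the
-- completion rebuild each element, by density.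
lemma CompletedTensor.ofTensor_bijective :
    Function.Bijective (ofTensor : B ⊗[F] V →+ CompletedTensor F B V) := by
  let b := Module.finBasis F B
  have hsum : ∀ x : B ⊗[F] V, ∑ i, b i ⊗ₜ[F] GaussTensor.contract (b.coord i) x = x :=
    TraceTensor.sum_basis_tmul_contract b
  constructor
  · rw [injective_iff_map_eq_zero]
    intro x hx
    have h0 : GaussTensor.gaussNorm x = 0 := by rw [← norm_ofTensor, hx, norm_zero]
    rw [← hsum x]
    refine Finset.sum_eq_zero fun i _ => ?_
    have h1 : ‖GaussTensor.contract (b.coord i) x‖ ≤ GaussTensor.gaussNorm x :=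
      GaussTensor.norm_contract_le hV (b.coord i) x
    rw [h0] at h1
    rw [norm_le_zero_iff.1 h1, TensorProduct.tmul_zero]
  · intro ω
    let ext : ∀ i, CompletedTensor F B V → V := fun i =>
      UniformSpace.Completion.extension (GaussTensor.contract (V := V) (b.coord i))
    have hext : ∀ i (x : B ⊗[F] V), ext i (ofTensor x) = GaussTensor.contract (b.coord i) x :=
      fun i x => UniformSpace.Completion.extension_coe
        (uniformContinuous_addMonoidHom_of_continuous
          (GaussTensor.continuous_contract hV (b.coord i))) x
    have hc : ∀ i, Continuous (ext i) := fun i => UniformSpace.Completion.continuous_extension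
    refine ⟨∑ i, b i ⊗ₜ[F] ext i ω, ?_⟩
    induction ω using isClosed_induction with
    | hp =>
      refine isClosed_eq ?_ continuous_id
      simp only [map_sum]
      exact continuous_finsetSum _ fun i _ => (continuous_tmul (b i)).comp (hc i)
    | h x => simp only [hext, hsum]

end FiniteDimensional

/-! ### Inverting perturbations of the identity -/

section Neumann

variable {G : Type*} [NormedAddCommGroup G] [CompleteSpace G]

/-- A preimage of `x` is a fixed point of the contraction `y ↦ x + f y`, which replaces summing the
Neumann series. -/
lemma bijective_sub_of_contracting (f : G →+ G) {r : ℝ} (hr0 : 0 ≤ r) (hr : r < 1)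
    (hf : ∀ y, ‖f y‖ ≤ r * ‖y‖) : Function.Bijective fun y => y - f y := by
  constructor
  · intro y z h
    have h1 : y - z = f (y - z) := by
      rw [map_sub]
      simp only at h
      rw [sub_eq_sub_iff_add_eq_add] at h ⊢
      rw [h, add_comm]
    have h2 := hf (y - z)
    rw [← h1] at h2
    have h3 : ‖y - z‖ ≤ 0 := by nlinarith [norm_nonneg (y - z)]
    exact sub_eq_zero.1 (norm_le_zero_iff.1 h3)
  · intro x
    have hc : ContractingWith ⟨r, hr0⟩ fun y => x + f y := by
      refine ⟨by exact_mod_cast hr, LipschitzWith.of_dist_le_mul fun y z => ?_⟩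
      rw [dist_add_left, dist_eq_norm, dist_eq_norm, ← map_sub]
      exact hf _
    refine ⟨ContractingWith.fixedPoint _ hc, ?_⟩
    have h := hc.fixedPoint_isFixedPt
    exact sub_eq_of_eq_add h.eq.symm

lemma isUnit_one_sub_of_contracting (f : AddMonoid.End G) {r : ℝ} (hr0 : 0 ≤ r) (hr : r < 1)
    (hf : ∀ y, ‖f y‖ ≤ r * ‖y‖) : IsUnit (1 - f) := by
  let e : G ≃+ G := AddEquiv.ofBijective (1 - f : AddMonoid.End G)
    (bijective_sub_of_contracting f hr0 hr hf)
  exact ⟨⟨1 - f, e.symm.toAddMonoidHom, AddMonoidHom.ext fun y => e.apply_symm_apply y,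
    AddMonoidHom.ext fun y => e.symm_apply_apply y⟩, rfl⟩

end Neumann

/-! ### Invertibility of `1 ⊗ ∂u - u ⊗ 1` on `Lie_E(𝕋)` -/

namespace AndersonModule

section Basic

variable {F A K C : Type*} [Field F] [Fintype F] [CommRing A] [Algebra F A]
  [Field K] [Algebra A K] [NormedField C] [Algebra K C] [Algebra F C]
  {L : IntermediateField K C} {d : ℕ} (E : AndersonModule F A L d)

instance [CompleteSpace C] : CompleteSpace E.Points := inferInstanceAs (CompleteSpace (Fin d → C))

instance [CompleteSpace C] : CompleteSpace E.Lie := inferInstanceAs (CompleteSpace (Fin d → C))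

instance [IsUltrametricDist C] : IsUltrametricDist E.Points :=
  inferInstanceAs (IsUltrametricDist (Fin d → C))

instance [IsUltrametricDist C] : IsUltrametricDist E.Lie :=
  inferInstanceAs (IsUltrametricDist (Fin d → C))

noncomputable instance : NormedSpace C E.Points := inferInstanceAs (NormedSpace C (Fin d → C))

noncomputable instance : NormedSpace C E.Lie := inferInstanceAs (NormedSpace C (Fin d → C))

instance : SMulCommClass A C E.Lie where
  smul_comm a t x := by
    have h : ∀ y : Fin d → C, (E.coeff a 0).mulVec (t • y) = t • (E.coeff a 0).mulVec y :=
      Matrix.mulVec_smul _ t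
    exact h x

lemma smul_lie_of_coeff {a : A} {t : C} (h : E.coeff a 0 = t • 1) (x : E.Lie) : a • x = t • x := by
  have h1 : ∀ y : Fin d → C, (E.coeff a 0).mulVec y = t • y := fun y => by
    rw [h, Matrix.smul_mulVec, Matrix.one_mulVec]
  exact h1 x

lemma smul_lie_eq (c : F) (x : E.Lie) : c • x = algebraMap F C c • x :=
  E.smul_lie_of_coeff (a := algebraMap F A c)
    (by rw [E.coeff_algebraMap, Finsupp.single_eq_same]) x

lemma smul_points_eq (c : F) (x : E.Points) : c • x = algebraMap F C c • x := by
  have h1 : ∀ y : Fin d → C, twistedEval F (E.coeff (algebraMap F A c)) y = algebraMap F C c • y :=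
    fun y => by
      rw [E.coeff_algebraMap, twistedEval, Finsupp.sum_single_index (by simp), Matrix.smul_mulVec,
        Matrix.one_mulVec, tau_zero_left]
  exact h1 x

/-- Multiplication by a scalar `t` on `Lie_E(ℂ_∞)`, which is `F`-linear. -/
noncomputable def scalarLie (t : C) : E.Lie →ₗ[F] E.Lie where
  toFun x := t • x
  map_add' := smul_add t
  map_smul' c x := (smul_comm (algebraMap F A c) t x).symm

lemma norm_scalarLie (t : C) (x : E.Lie) : ‖E.scalarLie t x‖ = ‖t‖ * ‖x‖ :=
  norm_smul t x

lemma continuous_scalarLie (t : C) : Continuous (E.scalarLie t) :=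
  continuous_const_smul t

omit [CommRing A] [Algebra F A] [Field K] [Algebra A K] [Algebra K C] in
-- Elements of `F` satisfy `c ^ q = c`, which no element of norm `> 1` can.
lemma norm_algebraMap_le_one (c : F) : ‖algebraMap F C c‖ ≤ 1 := by
  by_contra! h
  have h1 : algebraMap F C c ^ Fintype.card F = algebraMap F C c := by
    rw [← map_pow, FiniteField.pow_card]
  have h2 := lt_self_pow₀ h (Fintype.one_lt_card (α := F))
  rw [← norm_pow, h1] at h2
  exact lt_irrefl _ h2

lemma norm_smul_lie_le (c : F) (x : E.Lie) : ‖c • x‖ ≤ ‖x‖ := by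
  rw [smul_lie_eq]
  refine (norm_smul (algebraMap F C c) x).trans_le ?_
  exact mul_le_of_le_one_left (norm_nonneg _) (norm_algebraMap_le_one c)

lemma norm_smul_points_le (c : F) (x : E.Points) : ‖c • x‖ ≤ ‖x‖ := by
  rw [smul_points_eq]
  refine (norm_smul (algebraMap F C c) x).trans_le ?_
  exact mul_le_of_le_one_left (norm_nonneg _) (norm_algebraMap_le_one c)

/-- A suitable `p`-power of any `a` acts on the Lie algebra as a scalar. -/
lemma exists_coeff_pow_eq_smul (a : A) : ∃ n : ℕ, n ≠ 0 ∧
    E.coeff (a ^ n) 0 = algebraMap K C (algebraMap A K a) ^ n • 1 := by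
  set θ := algebraMap K C (algebraMap A K a) with hθ
  obtain ⟨n, hn⟩ := E.isNilpotent a
  obtain ⟨k, hp, hk⟩ := FiniteField.card F (ringChar F)
  have : Fact (ringChar F).Prime := ⟨hp⟩
  have : CharP C (ringChar F) := charP_of_injective_algebraMap (algebraMap F C).injective _
  refine ⟨Fintype.card F ^ n, card_pow_ne_zero F n, ?_⟩
  rw [coeff_pow_zero]
  -- For `d = 0` the matrix ring is trivial, so it does not have characteristic `p`; this case is
  -- settled apart.
  rcases Nat.eq_zero_or_pos d with rfl | hd
  · ext i; exact i.elim0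
  have : Nonempty (Fin d) := ⟨⟨0, hd⟩⟩
  have hsplit : E.coeff a 0 = θ • 1 + (E.coeff a 0 - θ • 1) := by abel
  have hcomm : Commute (θ • (1 : Matrix (Fin d) (Fin d) C)) (E.coeff a 0 - θ • 1) :=
    (Commute.one_left _).smul_left θ
  -- The exponent `q ^ n` is a power of the characteristic, so the power is additive on commuting
  -- summands; it exceeds the nilpotency exponent `n`, so only the scalar part survives.
  rw [hsplit, hk, ← pow_mul, add_pow_char_pow_of_commute _ _ hcomm, pow_mul, ← hk, smul_pow,
    one_pow, pow_eq_zero_of_le (lt_card_pow F n).le hn, add_zero]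

lemma smul_lie_cancel [IsDomain A] [IsFractionRing A K] {b : A} (hb : b ≠ 0) {x y : E.Lie} (h : b • x = b • y) : x = y :=
  (Matrix.mulVec_injective_of_isUnit (E.isUnit_coeff_zero hb) :
    Function.Injective fun x : Fin d → C => (E.coeff b 0).mulVec x) h

lemma dphi_mul (a b : A) : E.dphi (a * b) = E.dphi a ∘ₗ E.dphi b :=
  LinearMap.ext fun x => mul_smul a b x

lemma rightActLie_mul (a b : A) (y : E.TLie) :
    E.rightActLie (a * b) y = E.rightActLie a (E.rightActLie b y) := by
  rw [rightActLie, rightActLie, rightActLie, CompletedTensor.map_map _ _ _ _ _ _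
    ((E.continuous_dphi a).comp (E.continuous_dphi b))]
  simp only [dphi_mul, LinearMap.comp_id]

lemma rightActLie_one (y : E.TLie) : E.rightActLie 1 y = y := by
  have h : E.dphi 1 = LinearMap.id := LinearMap.ext fun x => one_smul A x
  simp only [rightActLie, h]
  exact CompletedTensor.map_id_id y

lemma rightActLie_smul (a b : A) (y : E.TLie) :
    E.rightActLie a (b • y) = b • E.rightActLie a y :=
  CompletedTensor.map_id_smul _ _ b y

/-- The right action of `a` on `Lie_E(𝕋)` as an element of the endomorphism ring. -/
noncomputable def rightActLieEnd (a : A) : AddMonoid.End E.TLie := E.rightActLie a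

lemma rightActLieEnd_pow (a : A) (n : ℕ) :
    E.rightActLieEnd a ^ n = E.rightActLieEnd (a ^ n) := by
  induction n with
  | zero => rw [pow_zero, pow_zero]; exact AddMonoidHom.ext fun y => (E.rightActLie_one y).symm
  | succ n ih =>
    rw [pow_succ, pow_succ, ih]
    exact AddMonoidHom.ext fun y => (E.rightActLie_mul _ _ y).symm

/-- The matrix `∂u` itself need not be expanding for the maximum norm, because of its nilpotent
part. Some power `(∂u)^n` is the scalar `θ^n`, with `|θ^n| > 1`, and it dominates the
norm-nonincreasing `u^n ⊗ 1`. -/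
lemma bijective_rightActLie_sub_smul [CompleteSpace C] {u : A}
    (hu : 1 < ‖algebraMap K C (algebraMap A K u)‖) :
    Function.Bijective fun y : E.TLie => E.rightActLie u y - u • y := by
  set θ := algebraMap K C (algebraMap A K u) with hθ
  obtain ⟨n, hn0, hn⟩ := E.exists_coeff_pow_eq_smul u
  rw [← hθ] at hn
  have hθ0 : θ ≠ 0 := norm_ne_zero_iff.1 (by positivity)
  let P : AddMonoid.End E.TLie := E.rightActLieEnd u
  let Q : AddMonoid.End E.TLie := Module.toAddMonoidEnd A E.TLie u
  have hPQ : Commute P Q := AddMonoidHom.ext fun y => E.rightActLie_smul u u y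
  let c : AddMonoid.End E.TLie :=
    CompletedTensor.map LinearMap.id (E.scalarLie (θ ^ n)⁻¹) (E.continuous_scalarLie _)
  have hc : ∀ y, ‖c y‖ ≤ ‖(θ ^ n)⁻¹‖ * ‖y‖ :=
    CompletedTensor.norm_map_le _ _ _ (norm_nonneg _) fun v => (E.norm_scalarLie _ v).le
  have hscal : ∀ (s t : C), s * t = 1 → E.scalarLie s ∘ₗ E.scalarLie t = LinearMap.id :=
    fun s t hst => LinearMap.ext fun x => by
      change s • t • x = x
      rw [smul_smul, hst, one_smul]
  have hPn' : E.dphi (u ^ n) = E.scalarLie (θ ^ n) := LinearMap.ext (E.smul_lie_of_coeff hn)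
  have hθn : θ ^ n ≠ 0 := pow_ne_zero _ hθ0
  have hcP : P ^ n * c = 1 := AddMonoidHom.ext fun y => by
    rw [rightActLieEnd_pow]
    exact CompletedTensor.map_id_map_id_of_comp_eq_id _ (E.continuous_scalarLie _)
      (E.dphi (u ^ n)) (E.continuous_dphi _) (by rw [hPn', hscal _ _ (mul_inv_cancel₀ hθn)]) y
  have hPc : c * P ^ n = 1 := AddMonoidHom.ext fun y => by
    rw [rightActLieEnd_pow]
    exact CompletedTensor.map_id_map_id_of_comp_eq_id (E.dphi (u ^ n)) (E.continuous_dphi _)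
      _ (E.continuous_scalarLie _) (by rw [hPn', hscal _ _ (inv_mul_cancel₀ hθn)]) y
  have hunit : IsUnit (P ^ n - Q ^ n) := by
    have h1 : P ^ n - Q ^ n = P ^ n * (1 - c * Q ^ n) := by
      rw [mul_sub, mul_one, ← mul_assoc, hcP, one_mul]
    rw [h1]
    refine IsUnit.mul ⟨⟨P ^ n, c, hcP, hPc⟩, rfl⟩ ?_
    refine isUnit_one_sub_of_contracting _ (norm_nonneg (θ ^ n)⁻¹) ?_ fun y => ?_
    · rw [norm_inv, norm_pow]
      exact inv_lt_one_of_one_lt₀ (one_lt_pow₀ hu hn0)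
    · refine (hc _).trans (mul_le_mul_of_nonneg_left ?_ (norm_nonneg _))
      have h2 : Q ^ n = Module.toAddMonoidEnd A E.TLie (u ^ n) := (map_pow _ u n).symm
      rw [h2]
      exact CompletedTensor.norm_smul_le_self _ _
  have hu2 : IsUnit (P - Q) := by
    -- `P - Q` is a factor of the unit `P ^ n - Q ^ n`. In the noncommutative endomorphism ring it
    -- must also be seen to commute with the cofactor before it can be called a unit.
    rw [← hPQ.mul_geom_sum₂] at hunit
    refine (Commute.isUnit_mul_iff ?_).1 hunit |>.1
    have hcP : Commute (P - Q) P := (Commute.refl P).sub_left hPQ.symm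
    have hcQ : Commute (P - Q) Q := hPQ.sub_left (Commute.refl Q)
    exact Commute.sum_right _ _ _ fun i _ => (hcP.pow_right _).mul_right (hcQ.pow_right _)
  obtain ⟨⟨v, w, hvw, hwv⟩, hv⟩ := hu2
  simp only at hv
  subst hv
  exact Function.bijective_iff_has_inverse.2 ⟨w, fun y => DFunLike.congr_fun hwv y,
    fun y => DFunLike.congr_fun hvw y⟩

end Basic

end AndersonModule

/-! ### The map `δ_u` -/

namespace AndersonModule

section Delta

attribute [local instance] FractionRing.liftAlgebra FractionRing.isScalarTower_liftAlgebra

variable {F A K C : Type*} [Field F] [Fintype F] [CommRing A] [IsDedekindDomain A] [Algebra F A]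
  [Field K] [Algebra F K] [Algebra A K] [IsFractionRing A K] [IsCoefficientRing F A K]
  [NormedField C] [CompleteSpace C] [IsUltrametricDist C] [Algebra K C] [Algebra F C]
  [IsCInfty A K C] {L : IntermediateField K C} {d : ℕ} (E : AndersonModule F A L d)

lemma expT_smul (a : A) (y : E.TLie) : E.expT (a • y) = a • E.expT y :=
  CompletedTensor.map_id_smul _ _ a y

lemma expT_rightActLie (a : A) (y : E.TLie) :
    E.expT (E.rightActLie a y) = E.rightAct a (E.expT y) := by
  have h : E.exp.restrictScalars F ∘ₗ E.dphi a = E.phi a ∘ₗ E.exp.restrictScalars F :=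
    LinearMap.ext fun x => E.exp.map_smul a x
  have hc : Continuous (E.exp.restrictScalars F) := E.continuous_exp
  exact CompletedTensor.map_map_eq_map_map (E.continuous_dphi a) hc hc (E.continuous_phi a) rfl h y

lemma expT_ofTensor (x : A ⊗[F] E.Lie) : E.expT (CompletedTensor.ofTensor x) =
    CompletedTensor.ofTensor ((E.exp.restrictScalars F).lTensor A x) :=
  CompletedTensor.map_ofTensor _ _ _ x

lemma latticeToTLie_apply (x : A ⊗[F] E.periodLattice) :
    E.latticeToTLie x = CompletedTensor.ofTensor
      ((E.periodLattice.subtype.restrictScalars F).lTensor A x) := rfl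

lemma expT_latticeToTLie (x : A ⊗[F] E.periodLattice) : E.expT (E.latticeToTLie x) = 0 := by
  rw [latticeToTLie_apply, expT_ofTensor]
  have h : E.exp.restrictScalars F ∘ₗ E.periodLattice.subtype.restrictScalars F = 0 :=
    LinearMap.ext fun l => l.2
  rw [← LinearMap.comp_apply, ← LinearMap.lTensor_comp, h, LinearMap.lTensor_zero,
    LinearMap.zero_apply, map_zero]

lemma latticeToTLie_smul (a : A) (x : A ⊗[F] E.periodLattice) :
    E.latticeToTLie (a • x) = a • E.latticeToTLie x := by
  rw [latticeToTLie_apply, latticeToTLie_apply, CompletedTensor.smul_ofTensor]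
  congr 1
  induction x using TensorProduct.induction_on with
  | zero => simp
  | tmul c l => simp [TensorProduct.smul_tmul']
  | add x y hx hy => simp only [smul_add, map_add, hx, hy]

lemma latticeToTLie_lTensor (a : A) (x : A ⊗[F] E.periodLattice) :
    E.latticeToTLie (((LinearMap.lsmul A E.periodLattice a).restrictScalars F).lTensor A x) =
      E.rightActLie a (E.latticeToTLie x) := by
  rw [latticeToTLie_apply, latticeToTLie_apply, rightActLie, CompletedTensor.map_ofTensor]
  congr 1
  induction x using TensorProduct.induction_on with
  | zero => simp
  | tmul c l => rfl
  | add x y hx hy => simp only [map_add, hx, hy]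

/-- The inverse of `1 ⊗ ∂ u - u ⊗ 1` on `Lie_E(𝕋)`. -/
noncomputable def resolvent {u : A} (hu : 1 < ‖algebraMap K C (algebraMap A K u)‖) :
    E.TLie ≃+ E.TLie :=
  (AddEquiv.ofBijective (E.rightActLie u - DistribSMul.toAddMonoidHom E.TLie u)
    (E.bijective_rightActLie_sub_smul hu)).symm

variable {u : A} (hu : 1 < ‖algebraMap K C (algebraMap A K u)‖)

lemma rightActLie_resolvent_sub (y : E.TLie) :
    E.rightActLie u (E.resolvent hu y) - u • E.resolvent hu y = y :=
  AddEquiv.apply_symm_apply (AddEquiv.ofBijective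
    (E.rightActLie u - DistribSMul.toAddMonoidHom E.TLie u) (E.bijective_rightActLie_sub_smul hu)) y

lemma resolvent_eq {x y : E.TLie} (h : E.rightActLie u y - u • y = x) : E.resolvent hu x = y :=
  (E.bijective_rightActLie_sub_smul hu).1 <| by
    simp only [rightActLie_resolvent_sub, h]

lemma resolvent_smul (a : A) (y : E.TLie) : E.resolvent hu (a • y) = a • E.resolvent hu y := by
  apply resolvent_eq
  rw [rightActLie_smul, smul_comm u a, ← smul_sub, rightActLie_resolvent_sub]

lemma resolvent_rightActLie (a : A) (y : E.TLie) :
    E.resolvent hu (E.rightActLie a y) = E.rightActLie a (E.resolvent hu y) := by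
  apply resolvent_eq
  rw [← rightActLie_mul, mul_comm, rightActLie_mul, ← rightActLie_smul, ← map_sub,
    rightActLie_resolvent_sub]

/-- The map `x ↦ (id ⊗̂ exp_E)((1 ⊗ ∂ u - u ⊗ 1)⁻¹ x)` on `A ⊗_F Λ_E`. -/
noncomputable def deltaLift : A ⊗[F] E.periodLattice →+ E.TPoints :=
  E.expT.comp ((E.resolvent hu).toAddMonoidHom.comp E.latticeToTLie)

lemma deltaLift_apply (x : A ⊗[F] E.periodLattice) :
    E.deltaLift hu x = E.expT (E.resolvent hu (E.latticeToTLie x)) := rfl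

lemma deltaLift_smul (a : A) (x : A ⊗[F] E.periodLattice) :
    E.deltaLift hu (a • x) = a • E.deltaLift hu x := by
  simp only [deltaLift_apply, latticeToTLie_smul, resolvent_smul, expT_smul]

lemma deltaLift_lTensor (a : A) (x : A ⊗[F] E.periodLattice) :
    E.deltaLift hu (((LinearMap.lsmul A E.periodLattice a).restrictScalars F).lTensor A x) =
      E.rightAct a (E.deltaLift hu x) := by
  simp only [deltaLift_apply, latticeToTLie_lTensor, resolvent_rightActLie, expT_rightActLie]

/-- The difference of the two tensors is, up to sign, `1 ⊗ ∂u - u ⊗ 1` applied to `a ⊗ l`. The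
resolvent cancels this operator and leaves `a ⊗ l`, which `exp_E` kills because `l` is a period. -/
lemma deltaLift_mul_tmul (a : A) (l : E.periodLattice) :
    E.deltaLift hu ((u * a) ⊗ₜ l) = E.deltaLift hu (a ⊗ₜ (u • l)) := by
  rw [← sub_eq_zero, ← neg_eq_zero, neg_sub, ← map_sub, deltaLift_apply]
  have h1 : E.latticeToTLie (a ⊗ₜ (u • l) - (u * a) ⊗ₜ l) =
      E.rightActLie u (E.latticeToTLie (a ⊗ₜ l)) - u • E.latticeToTLie (a ⊗ₜ l) := by
    rw [← latticeToTLie_lTensor, ← latticeToTLie_smul, ← map_sub]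
    rfl
  rw [E.resolvent_eq hu h1.symm, expT_latticeToTLie]

lemma deltaLift_adjoin_tmul (r : adjoinRing F u) (a : A) (l : E.periodLattice) :
    E.deltaLift hu ((r • a) ⊗ₜ l) = E.deltaLift hu (a ⊗ₜ (r • l)) := by
  obtain ⟨r, hr⟩ := r
  change E.deltaLift hu ((r * a) ⊗ₜ l) = E.deltaLift hu (a ⊗ₜ (r • l))
  induction hr using Algebra.adjoin_induction generalizing a l with
  | mem x hx =>
    rw [Set.mem_singleton_iff] at hx
    subst hx
    exact E.deltaLift_mul_tmul hu a l
  | algebraMap c =>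
    rw [← Algebra.smul_def, TensorProduct.smul_tmul, algebraMap_smul]
  | add x y _ _ hx hy =>
    rw [add_mul, TensorProduct.add_tmul, map_add, hx, hy, add_smul, TensorProduct.tmul_add, map_add]
  | mul x y _ _ hx hy =>
    rw [mul_assoc, hx, hy, smul_smul, mul_comm y x]

/-- The map `x ↦ (id ⊗̂ exp_E)((1 ⊗ ∂ u - u ⊗ 1)⁻¹ x)` on `A ⊗_{F[u]} Λ_E`. -/
noncomputable def deltaTilde : A ⊗[adjoinRing F u] E.periodLattice →+ E.TPoints :=
  TensorProduct.liftAddHom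
    (AddMonoidHom.mk' (fun a => (E.deltaLift hu).comp
        (TensorProduct.mk F A E.periodLattice a).toAddMonoidHom)
      fun a b => AddMonoidHom.ext fun l => by
        simp only [AddMonoidHom.comp_apply, AddMonoidHom.add_apply, ← map_add]
        congr 1
        exact TensorProduct.add_tmul a b l)
    fun r a l => E.deltaLift_adjoin_tmul hu r a l

lemma deltaTilde_toTensorAdjoin (x : A ⊗[F] E.periodLattice) :
    E.deltaTilde hu (E.toTensorAdjoin u x) = E.deltaLift hu x := by
  induction x using TensorProduct.induction_on with
  | zero => simp
  | tmul a l => rfl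
  | add x y hx hy => simp only [map_add, hx, hy]

lemma toTensorAdjoin_surjective (u : A) : Function.Surjective (E.toTensorAdjoin u) := by
  intro x
  induction x using TensorProduct.induction_on with
  | zero => exact ⟨0, map_zero _⟩
  | tmul a l => exact ⟨a ⊗ₜ l, rfl⟩
  | add x y hx hy =>
    obtain ⟨x', rfl⟩ := hx
    obtain ⟨y', rfl⟩ := hy
    exact ⟨x' + y', map_add _ _ _⟩

lemma toTensorAdjoin_smul (a : A) (x : A ⊗[F] E.periodLattice) :
    E.toTensorAdjoin u (a • x) = a • E.toTensorAdjoin u x := by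
  induction x using TensorProduct.induction_on with
  | zero => simp
  | tmul c l => rfl
  | add x y hx hy => simp only [smul_add, map_add, hx, hy]

lemma toTensorAdjoin_lTensor (a : A) (x : A ⊗[F] E.periodLattice) :
    E.toTensorAdjoin u (((LinearMap.lsmul A E.periodLattice a).restrictScalars F).lTensor A x) =
      ((LinearMap.lsmul A E.periodLattice a).restrictScalars (adjoinRing F u)).lTensor A
        (E.toTensorAdjoin u x) := by
  induction x using TensorProduct.induction_on with
  | zero => simp
  | tmul c l => rfl
  | add x y hx hy => simp only [map_add, hx, hy]

lemma deltaTilde_smul (a : A) (x : A ⊗[adjoinRing F u] E.periodLattice) :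
    E.deltaTilde hu (a • x) = a • E.deltaTilde hu x := by
  obtain ⟨x, rfl⟩ := E.toTensorAdjoin_surjective u x
  rw [← toTensorAdjoin_smul, deltaTilde_toTensorAdjoin, deltaTilde_toTensorAdjoin, deltaLift_smul]

lemma deltaTilde_lTensor (a : A) (x : A ⊗[adjoinRing F u] E.periodLattice) :
    E.deltaTilde hu (((LinearMap.lsmul A E.periodLattice a).restrictScalars
      (adjoinRing F u)).lTensor A x) = E.rightAct a (E.deltaTilde hu x) := by
  obtain ⟨x, rfl⟩ := E.toTensorAdjoin_surjective u x
  rw [← toTensorAdjoin_lTensor, deltaTilde_toTensorAdjoin, deltaTilde_toTensorAdjoin,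
    deltaLift_lTensor]

/-- The existential choices in `IsDeltaTilde` are harmless: the resolvent equation has one solution,
and the result does not depend on the representative over `F`. -/
lemma isDeltaTilde_iff (x : A ⊗[adjoinRing F u] E.periodLattice) (ω : E.TPoints) :
    E.IsDeltaTilde u x ω ↔ E.deltaTilde hu x = ω := by
  constructor
  · rintro ⟨x', rfl, y, hy, rfl⟩
    rw [deltaTilde_toTensorAdjoin, deltaLift_apply, E.resolvent_eq hu hy]
  · rintro rfl
    obtain ⟨x, rfl⟩ := E.toTensorAdjoin_surjective u x
    exact ⟨x, rfl, _, E.rightActLie_resolvent_sub hu _, E.deltaTilde_toTensorAdjoin hu x⟩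

/-- For a generator `r • l`, a diagonal tensor in `A ⊗ A` with product `r` is pushed forward along
the `A`-linear map `A → Λ_E`, `1 ↦ l`; this respects both actions and the product. -/
lemma exists_isDiagonal_mulMap [Module.Finite (adjoinRing F u) A]
    [Algebra.IsSeparable (FractionRing (adjoinRing F u)) (FractionRing A)]
    {μ : E.Lie} (hμ : μ ∈ E.differentLattice u) :
    ∃ x : A ⊗[adjoinRing F u] E.periodLattice,
      TraceTensor.IsDiagonal x ∧ (E.mulMap u x : E.Lie) = μ := by
  induction hμ using Submodule.smul_induction_on' with
  | smul r hr l hl =>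
    obtain ⟨x, hx, hxr⟩ := TraceTensor.exists_isDiagonal hr
    let f : A →ₗ[A] E.periodLattice := LinearMap.toSpanSingleton A _ ⟨l, hl⟩
    let G := (f.restrictScalars (adjoinRing F u)).lTensor A
    have h1 : ∀ (a : A) (y : A ⊗[adjoinRing F u] A), G (a • y) = a • G y := by
      intro a y
      induction y using TensorProduct.induction_on with
      | zero => simp
      | tmul c l => rfl
      | add x y hx hy => simp only [smul_add, map_add, hx, hy]
    have h2 : ∀ (a : A) (y : A ⊗[adjoinRing F u] A),
        G (((LinearMap.lsmul A A a).restrictScalars (adjoinRing F u)).lTensor A y) =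
        ((LinearMap.lsmul A E.periodLattice a).restrictScalars (adjoinRing F u)).lTensor A
          (G y) := by
      intro a y
      induction y using TensorProduct.induction_on with
      | zero => simp
      | tmul c l => exact congrArg (c ⊗ₜ[adjoinRing F u] ·) (f.map_smul a l)
      | add x y hx hy => simp only [map_add, hx, hy]
    have h3 : ∀ y : A ⊗[adjoinRing F u] A, E.mulMap u (G y) = f (TraceTensor.mul y) := by
      intro y
      induction y using TensorProduct.induction_on with
      | zero => simp
      | tmul c l => exact (f.map_smul c l).symm
      | add x y hx hy => simp only [map_add, hx, hy]
    refine ⟨G x, fun a => ?_, ?_⟩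
    · rw [← h1, hx a, h2]
    · rw [h3, hxr]; rfl
  | add x hx y hy hx' hy' =>
    obtain ⟨x1, h1, h2⟩ := hx'
    obtain ⟨y1, h3, h4⟩ := hy'
    refine ⟨x1 + y1, h1.add h3, ?_⟩
    rw [map_add, Submodule.coe_add, h2, h4]

lemma eq_of_isDiagonal_mulMap [Module.Finite (adjoinRing F u) A]
    [Algebra.IsSeparable (FractionRing (adjoinRing F u)) (FractionRing A)]
    {x y : A ⊗[adjoinRing F u] E.periodLattice} (hx : TraceTensor.IsDiagonal x)
    (hy : TraceTensor.IsDiagonal y) (h : E.mulMap u x = E.mulMap u y) : x = y := by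
  classical
  rw [← sub_eq_zero]
  refine TraceTensor.eq_zero_of_isDiagonal (Module.Free.chooseBasis (adjoinRing F u) A)
    (TraceTensor.discr_ne_zero _) (fun r m hr hm => ?_) (hx.sub hy) ?_
  -- The period lattice is torsion-free because nonzero elements of `A` act invertibly on the Lie
  -- algebra.
  · have hr' : (r : A) ≠ 0 := fun h => hr (Subtype.ext h)
    refine Subtype.ext (E.smul_lie_cancel hr' ?_)
    rw [Submodule.coe_zero, smul_zero]
    exact congrArg Subtype.val hm
  · have h' : E.mulMap u (x - y) = 0 := by rw [map_sub, h, sub_self]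
    exact h'

include hu in
-- Uniqueness of the diagonal `x` turns the relation `IsDelta` into a function and makes it
-- `A`-linear. Equality of the two actions on `x` passes to its image, which is therefore a special
-- function.
lemma exists_delta [Module.Finite (adjoinRing F u) A]
    [Algebra.IsSeparable (FractionRing (adjoinRing F u)) (FractionRing A)] :
    ∃ δ : E.differentLattice u →ₗ[A] E.specialFunctions,
      (∀ μ ω, E.IsDelta u μ ω ↔ (δ μ : E.TPoints) = ω) := by
  choose x hx hxμ using fun μ : E.differentLattice u => E.exists_isDiagonal_mulMap μ.2
  have hxs : ∀ (μ : E.differentLattice u) (y : A ⊗[adjoinRing F u] E.periodLattice), TraceTensor.IsDiagonal y →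
      (E.mulMap u y : E.Lie) = μ → y = x μ := fun μ y hy hyμ =>
    E.eq_of_isDiagonal_mulMap hy (hx μ) (Subtype.ext (hyμ.trans (hxμ μ).symm))
  have hmem : ∀ μ, E.deltaTilde hu (x μ) ∈ E.specialFunctions := fun μ a => by
    rw [← deltaTilde_smul, hx μ a, deltaTilde_lTensor]
  have hsmul : ∀ (a : A) (y : A ⊗[adjoinRing F u] E.periodLattice),
      E.mulMap u (a • y) = a • E.mulMap u y := fun a y => TraceTensor.mul_smul a y
  refine ⟨{ toFun := fun μ => ⟨E.deltaTilde hu (x μ), hmem μ⟩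
            map_add' := fun μ ν => Subtype.ext ?_
            map_smul' := fun a μ => Subtype.ext ?_ }, fun μ ω => ⟨?_, ?_⟩⟩
  · change E.deltaTilde hu (x (μ + ν)) = E.deltaTilde hu (x μ) + E.deltaTilde hu (x ν)
    rw [← map_add, hxs (μ + ν) (x μ + x ν) ((hx μ).add (hx ν))
      (by rw [map_add, Submodule.coe_add, hxμ, hxμ]; rfl)]
  · change E.deltaTilde hu (x (a • μ)) = a • E.deltaTilde hu (x μ)
    rw [← deltaTilde_smul, hxs (a • μ) (a • x μ) ((hx μ).smul a)
      (by rw [hsmul, Submodule.coe_smul, hxμ]; rfl)]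
  · rintro ⟨y, hy, hyμ, h⟩
    rw [isDeltaTilde_iff E hu, hxs μ y hy hyμ] at h
    exact h
  · intro h
    exact ⟨x μ, hx μ, hxμ μ, (E.isDeltaTilde_iff hu _ _).2 h⟩

end Delta

end AndersonModule

namespace MultiplicativeCharacter

variable {A : Type*} [CommRing A] {𝔭 : Ideal A} (χ : MultiplicativeCharacter 𝔭)

lemma lift_of_mem (h𝔭 : 𝔭 ≠ ⊤) {a : A} (ha : a ∈ 𝔭) : χ.lift a = 0 := by
  have : Nontrivial (A ⧸ 𝔭) := Ideal.Quotient.nontrivial_iff.2 h𝔭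
  rw [lift, dif_neg]
  rw [Ideal.Quotient.eq_zero_iff_mem.2 ha]
  exact not_isUnit_zero

lemma lift_of_mk_eq {a : A} {v : (A ⧸ 𝔭)ˣ} (h : Ideal.Quotient.mk 𝔭 a = v) : χ.lift a = χ v := by
  have hu : IsUnit (Ideal.Quotient.mk 𝔭 a) := ⟨v, h.symm⟩
  rw [lift, dif_pos hu]
  congr 2
  exact Units.ext h

end MultiplicativeCharacter

/-! ### The operators `∂ r` for `r` in `K` -/

namespace AndersonModule

section Fractions

variable {F A K C : Type*} [Field F] [Fintype F] [CommRing A] [IsDomain A] [Algebra F A]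
  [Field K] [Algebra A K] [IsFractionRing A K] [NormedField C] [Algebra K C] [Algebra F C]
  {L : IntermediateField K C} {d : ℕ} (E : AndersonModule F A L d)

lemma exists_mul_eq_algebraMap (A : Type*) {K : Type*} [CommRing A] [IsDomain A] [Field K]
    [Algebra A K] [IsFractionRing A K] (r : K) :
    ∃ a b : A, b ≠ 0 ∧ algebraMap A K b * r = algebraMap A K a := by
  obtain ⟨⟨a, b⟩, h⟩ := IsLocalization.surj A⁰ r
  exact ⟨a, b, nonZeroDivisors.ne_zero b.2, by rw [mul_comm]; exact h⟩

/-- The fraction chosen inside `dK` never matters: when `b * r = c` with `b` nonzero, `∂r x` is the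
only solution `y` of `b • y = c • x`. Identities are checked after clearing denominators. -/
lemma dK_mul (a : A) (r : K) (x : E.Lie) : E.dK (algebraMap A K a * r) x = a • E.dK r x := by
  obtain ⟨c, b, hb, h⟩ := exists_mul_eq_algebraMap A r
  apply E.smul_lie_cancel hb
  rw [E.smul_dK (a := a * c) (by rw [mul_left_comm, h, map_mul]), smul_comm, E.smul_dK h,
    smul_smul]

lemma dK_algebraMap (a : A) (x : E.Lie) : E.dK (algebraMap A K a) x = a • x := by
  apply E.smul_lie_cancel one_ne_zero
  rw [E.smul_dK (a := a) (by rw [map_one, one_mul]), one_smul]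

/-- The map `∂ r` as an `A`-linear map. -/
noncomputable def dKLinear (r : K) : E.Lie →ₗ[A] E.Lie where
  toFun := E.dK r
  map_add' x y := Matrix.mulVec_add _ (x : Fin d → C) y
  map_smul' a x := by
    obtain ⟨c, b, hb, h⟩ := exists_mul_eq_algebraMap A r
    apply E.smul_lie_cancel hb
    rw [E.smul_dK h, RingHom.id_apply, smul_comm b a, E.smul_dK h, smul_comm]

@[simp] lemma dKLinear_apply (r : K) (x : E.Lie) : E.dKLinear r x = E.dK r x := rfl

end Fractions

/-! ### Gauss–Thakur sums and evaluation of special functions -/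

section GaussSum

variable {F A K C : Type*} [Field F] [Fintype F] [CommRing A] [Algebra F A]
  [Field K] [Algebra A K] [NormedField C] [Algebra K C] [Algebra F C]
  {L : IntermediateField K C} {d : ℕ} (E : AndersonModule F A L d) {𝔭 : Ideal A}

lemma gaussThakurSum_eq_sum [Fintype (A ⧸ 𝔭)ˣ] (χ : MultiplicativeCharacter 𝔭)
    (ψ : (A ⧸ 𝔭) →ₗ[A] E.Points) : E.gaussThakurSum χ ψ =
      -∑ x : (A ⧸ 𝔭)ˣ, (((χ x)⁻¹ : (A ⧸ 𝔭)ˣ) : A ⧸ 𝔭) ⊗ₜ[F] ψ (x : A ⧸ 𝔭) := by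
  rw [gaussThakurSum, finsum_eq_sum_of_fintype]

lemma gaussThakurSum_smul [Finite (A ⧸ 𝔭)] (χ : MultiplicativeCharacter 𝔭)
    (a : A) (ψ : (A ⧸ 𝔭) →ₗ[A] E.Points) :
    E.gaussThakurSum χ (a • ψ) = (E.phi a).lTensor (A ⧸ 𝔭) (E.gaussThakurSum χ ψ) := by
  have := Fintype.ofFinite (A ⧸ 𝔭)ˣ
  rw [gaussThakurSum_eq_sum, gaussThakurSum_eq_sum, map_neg, map_sum]
  rfl

lemma gaussThakurSum_add [Finite (A ⧸ 𝔭)] (χ : MultiplicativeCharacter 𝔭)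
    (ψ ψ' : (A ⧸ 𝔭) →ₗ[A] E.Points) :
    E.gaussThakurSum χ (ψ + ψ') = E.gaussThakurSum χ ψ + E.gaussThakurSum χ ψ' := by
  have := Fintype.ofFinite (A ⧸ 𝔭)ˣ
  simp only [gaussThakurSum_eq_sum, LinearMap.add_apply, TensorProduct.tmul_add,
    Finset.sum_add_distrib, neg_add]

/-- For `a ∉ 𝔭` this is the substitution `x ↦ a x` in the sum over units; for `a ∈ 𝔭` both sides
vanish. Only multiplicativity of `χ` enters. -/
lemma gaussThakurSum_mem [𝔭.IsMaximal] [Finite (A ⧸ 𝔭)] (χ : MultiplicativeCharacter 𝔭)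
    (ψ : (A ⧸ 𝔭) →ₗ[A] E.Points) : E.gaussThakurSum χ ψ ∈ E.gaussThakurSpace χ := by
  have := Fintype.ofFinite (A ⧸ 𝔭)ˣ
  intro a
  have hmul : ∀ x : A ⧸ 𝔭, a • ψ x = ψ (Ideal.Quotient.mk 𝔭 a * x) := fun x => by
    rw [← map_smul]; rfl
  rw [← gaussThakurSum_smul, gaussThakurSum_eq_sum, gaussThakurSum_eq_sum]
  simp only [LinearMap.smul_apply, hmul]
  by_cases ha : a ∈ 𝔭
  · rw [χ.lift_of_mem (Ideal.IsMaximal.ne_top inferInstance) ha, zero_smul,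
      Ideal.Quotient.eq_zero_iff_mem.2 ha]
    simp
  · let := Ideal.Quotient.field 𝔭
    have hne : Ideal.Quotient.mk 𝔭 a ≠ 0 := fun h => ha (Ideal.Quotient.eq_zero_iff_mem.1 h)
    have hunit : IsUnit (Ideal.Quotient.mk 𝔭 a) := isUnit_iff_ne_zero.2 hne
    obtain ⟨v, hv⟩ := hunit
    rw [χ.lift_of_mk_eq hv.symm, smul_neg, neg_inj, Finset.smul_sum]
    refine Fintype.sum_equiv (Equiv.mulLeft v) _ _ fun x => ?_
    rw [TensorProduct.smul_tmul', Equiv.coe_mulLeft, smul_eq_mul, Units.val_mul,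
      ← hv, map_mul χ, mul_inv, Units.val_mul, Units.mul_inv_cancel_left]

/-- The Gauss–Thakur sum as an `A`-linear function of the additive character. -/
noncomputable def gaussThakurLinear [𝔭.IsMaximal] [Finite (A ⧸ 𝔭)] (χ : MultiplicativeCharacter 𝔭) :
    ((A ⧸ 𝔭) →ₗ[A] E.Points) →ₗ[A] E.gaussThakurSpace χ where
  toFun ψ := ⟨E.gaussThakurSum χ ψ, E.gaussThakurSum_mem χ ψ⟩
  map_add' ψ ψ' := Subtype.ext (E.gaussThakurSum_add χ ψ ψ')
  map_smul' a ψ := Subtype.ext (E.gaussThakurSum_smul χ a ψ)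

/-- The `A`-linear map from `A / 𝔭` determined by a `𝔭`-torsion point, depending linearly on it. -/
noncomputable def additiveCharacter {M : Type*} [AddCommGroup M] [Module A M]
    (η : M →ₗ[A] E.Points) (hη : ∀ m, ∀ a ∈ 𝔭, a • η m = 0) :
    M →ₗ[A] (A ⧸ 𝔭) →ₗ[A] E.Points where
  toFun m := Submodule.liftQ 𝔭 (LinearMap.toSpanSingleton A E.Points (η m)) fun a ha => hη m a ha
  map_add' m n := LinearMap.ext fun x => by
    obtain ⟨c, rfl⟩ := Ideal.Quotient.mk_surjective x
    change c • η (m + n) = c • η m + c • η n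
    rw [map_add, smul_add]
  map_smul' a m := LinearMap.ext fun x => by
    obtain ⟨c, rfl⟩ := Ideal.Quotient.mk_surjective x
    change c • η (a • m) = a • c • η m
    rw [map_smul, smul_comm]

@[simp] lemma additiveCharacter_mk {M : Type*} [AddCommGroup M] [Module A M]
    (η : M →ₗ[A] E.Points) (hη : ∀ m, ∀ a ∈ 𝔭, a • η m = 0) (m : M) (a : A) :
    E.additiveCharacter η hη m (Ideal.Quotient.mk 𝔭 a) = a • η m := rfl

variable [CompleteSpace C] [IsUltrametricDist C]

lemma ofTensor_points_bijective (B : Type*) [CommRing B] [Algebra F B] [Module.Finite F B] :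
    Function.Bijective (CompletedTensor.ofTensor : B ⊗[F] E.Points →+ _) :=
  CompletedTensor.ofTensor_bijective E.norm_smul_points_le

lemma ofTensor_lie_bijective (B : Type*) [CommRing B] [Algebra F B] [Module.Finite F B] :
    Function.Bijective (CompletedTensor.ofTensor : B ⊗[F] E.Lie →+ _) :=
  CompletedTensor.ofTensor_bijective E.norm_smul_lie_le

lemma evalAt_smul {χ : MultiplicativeCharacter 𝔭} (hχ : χ.IsEvaluative F) (a : A) (ω : E.TPoints) :
    E.evalAt hχ (a • ω) = χ.lift a • E.evalAt hχ ω := by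
  rw [← hχ.algHom_apply]
  exact CompletedTensor.map_algHom_smul hχ.algHom _ continuous_id a ω

lemma evalAt_rightAct {χ : MultiplicativeCharacter 𝔭} (hχ : χ.IsEvaluative F) (a : A)
    {ω : E.TPoints} {w : (A ⧸ 𝔭) ⊗[F] E.Points}
    (hw : CompletedTensor.ofTensor w = E.evalAt hχ ω) :
    E.evalAt hχ (E.rightAct a ω) = CompletedTensor.ofTensor ((E.phi a).lTensor (A ⧸ 𝔭) w) := by
  rw [LinearMap.lTensor, ← CompletedTensor.map_ofTensor _ _ (E.continuous_phi a), hw]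
  exact CompletedTensor.map_map_eq_map_map _ _ _ _ (by rw [LinearMap.comp_id, LinearMap.id_comp])
    (by rw [LinearMap.comp_id, LinearMap.id_comp]) ω

/-- Evaluation turns `a ⊗ 1` into `χ(a) ⊗ 1` and commutes with `1 ⊗ a`. On special functions the two
actions agree, which gives both membership in `G(E, χ)` and linearity. Values descend from the
completion because `𝔽_𝔭` is finite-dimensional. -/
lemma exists_evaluation [Module.Finite F (A ⧸ 𝔭)] {χ : MultiplicativeCharacter 𝔭}
    (hχ : χ.IsEvaluative F) :
    ∃ ev : E.specialFunctions →ₗ[A] E.gaussThakurSpace χ, ∀ ω : E.specialFunctions,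
      CompletedTensor.ofTensor (ev ω : (A ⧸ 𝔭) ⊗[F] E.Points) = E.evalAt hχ (ω : E.TPoints) := by
  have hbij := E.ofTensor_points_bijective (A ⧸ 𝔭)
  choose w hw using fun ω : E.specialFunctions => hbij.2 (E.evalAt hχ ω)
  have hmem : ∀ ω, w ω ∈ E.gaussThakurSpace χ := fun ω a => hbij.1 <| by
    rw [← E.evalAt_rightAct hχ a (hw ω), ← ω.2 a, evalAt_smul, ← hw,
      CompletedTensor.smul_ofTensor]
  refine ⟨{ toFun := fun ω => ⟨w ω, hmem ω⟩
            map_add' := fun ω ω' => Subtype.ext (hbij.1 ?_)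
            map_smul' := fun a ω => Subtype.ext (hbij.1 ?_) }, hw⟩
  · change CompletedTensor.ofTensor (w (ω + ω')) = CompletedTensor.ofTensor (w ω + w ω')
    rw [map_add, hw, hw, hw, Submodule.coe_add, map_add]
  · change CompletedTensor.ofTensor (w (a • ω)) =
      CompletedTensor.ofTensor ((E.phi a).lTensor (A ⧸ 𝔭) (w ω))
    rw [hw, ← E.evalAt_rightAct hχ a (hw ω), Submodule.coe_smul, ω.2 a]

end GaussSum

/-! ### Evaluation of `δ_u` compared with the Gauss–Thakur sum -/

section Comparison

variable {F A K C : Type*} [Field F] [Fintype F] [CommRing A] [IsDedekindDomain A] [Algebra F A]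
  [Field K] [Algebra F K] [Algebra A K] [IsFractionRing A K] [IsCoefficientRing F A K]
  [NormedField C] [CompleteSpace C] [IsUltrametricDist C] [Algebra K C] [Algebra F C]
  [IsCInfty A K C] {L : IntermediateField K C} {d : ℕ} (E : AndersonModule F A L d) {𝔭 : Ideal A}
  {χ : MultiplicativeCharacter 𝔭} (hχ : χ.IsEvaluative F)

/-- The map `λ ↦ exp_E (∂ z λ)` on the period lattice. -/
noncomputable def expDK (z : K) : E.periodLattice →ₗ[A] E.Points :=
  E.exp ∘ₗ E.dKLinear z ∘ₗ E.periodLattice.subtype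

lemma expDK_apply (z : K) (l : E.periodLattice) : E.expDK z l = E.exp (E.dK z l) := rfl

lemma smul_expDK (a : A) (z : K) (l : E.periodLattice) :
    a • E.expDK z l = E.exp (E.dK (algebraMap A K a * z) l) := by
  rw [dK_mul, map_smul, expDK_apply]

/-- Evaluation of `(id ⊗̂ exp_E) y`, where `y = (1 ⊗ ∂ u - u ⊗ 1)⁻¹ x`, at a character that
vanishes at `u`. -/
lemma eq_map_expDK_of_evalAt [Module.Finite F (A ⧸ 𝔭)] {u e : A} {z : K} (hu : χ.lift u = 0)
    (he : algebraMap A K u * z = algebraMap A K e) (hχe : χ.lift e = 1)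
    {x : A ⊗[F] E.periodLattice} {y : E.TLie}
    (hy : E.rightActLie u y - u • y = E.latticeToTLie x)
    {w : (A ⧸ 𝔭) ⊗[F] E.Points} (hws : w ∈ E.gaussThakurSpace χ)
    (hw : CompletedTensor.ofTensor w = E.evalAt hχ (E.expT y)) :
    w = TensorProduct.map hχ.algHom.toLinearMap ((E.expDK z).restrictScalars F) x := by
  have hbij := E.ofTensor_lie_bijective (A ⧸ 𝔭)
  have hexp : Continuous (E.exp.restrictScalars F) := E.continuous_exp
  let ev : E.TLie →+ CompletedTensor F (A ⧸ 𝔭) E.Lie :=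
    CompletedTensor.map hχ.algHom.toLinearMap LinearMap.id continuous_id
  obtain ⟨t, ht⟩ := hbij.2 (ev y)
  -- Evaluating the resolvent equation at `χ` removes the term `u • y`, since `χ(u) = 0`; what
  -- remains is `(1 ⊗ ∂u) t = (χ ⊗ id) x`.
  have hut : (E.dphi u).lTensor (A ⧸ 𝔭) t =
      TensorProduct.map hχ.algHom.toLinearMap (E.periodLattice.subtype.restrictScalars F) x := by
    apply hbij.1
    have h1 : ev (E.rightActLie u y) =
        CompletedTensor.ofTensor ((E.dphi u).lTensor (A ⧸ 𝔭) t) := by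
      rw [LinearMap.lTensor, ← CompletedTensor.map_ofTensor _ _ (E.continuous_dphi u), ht]
      exact CompletedTensor.map_map_eq_map_map _ _ _ _
        (by rw [LinearMap.comp_id, LinearMap.id_comp])
        (by rw [LinearMap.comp_id, LinearMap.id_comp]) y
    have h2 : ev (u • y) = 0 := by
      have h3 : ev (u • y) = hχ.algHom u • ev y :=
        CompletedTensor.map_algHom_smul hχ.algHom _ continuous_id u y
      rw [h3, hχ.algHom_apply, hu, zero_smul]
    have h4 := congrArg ev hy
    rw [map_sub, h1, h2, sub_zero] at h4
    rw [h4, latticeToTLie_apply]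
    refine (CompletedTensor.map_ofTensor _ _ _ _).trans ?_
    rw [LinearMap.lTensor, ← LinearMap.comp_apply, ← TensorProduct.map_comp, LinearMap.id_comp,
      LinearMap.comp_id]
  have hwt : w = (E.exp.restrictScalars F).lTensor (A ⧸ 𝔭) t := by
    apply (E.ofTensor_points_bijective (A ⧸ 𝔭)).1
    rw [hw, LinearMap.lTensor, ← CompletedTensor.map_ofTensor _ _ hexp, ht]
    exact CompletedTensor.map_map_eq_map_map _ _ _ _
      (by rw [LinearMap.comp_id, LinearMap.id_comp])
      (by rw [LinearMap.comp_id, LinearMap.id_comp]) y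
  -- Since `e = u z`, acting by `e` after `exp_E` is `exp_E ∂z ∂u`. This exposes the factor `∂u t`,
  -- the only thing known about `t`.
  have hcomp : E.phi e ∘ₗ E.exp.restrictScalars F =
      (E.exp ∘ₗ E.dKLinear z).restrictScalars F ∘ₗ E.dphi u := LinearMap.ext fun v => by
    change e • E.exp v = E.exp (E.dKLinear z (u • v))
    rw [(E.dKLinear z).map_smul, dKLinear_apply, ← dK_mul, he, dK_algebraMap, map_smul]
  -- On `G(E, χ)` the element `e` acts as `χ(e) = 1`, so it may be inserted freely.
  calc w = (E.phi e).lTensor (A ⧸ 𝔭) w := by rw [hws e, hχe, one_smul]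
    _ = ((E.exp ∘ₗ E.dKLinear z).restrictScalars F).lTensor (A ⧸ 𝔭)
        ((E.dphi u).lTensor (A ⧸ 𝔭) t) := by
      rw [hwt, ← LinearMap.comp_apply, ← LinearMap.lTensor_comp, hcomp, LinearMap.lTensor_comp,
        LinearMap.comp_apply]
    _ = _ := by
      rw [hut, LinearMap.lTensor, ← LinearMap.comp_apply, ← TensorProduct.map_comp,
        LinearMap.id_comp]
      rfl

/-- Both sides result from applying `-∑_v χ(v)⁻¹ ⊗ φ_v` to the left-hand value. The operator fixes
`G(E, χ)` pointwise, and on the image of any tensor it yields the Gauss–Thakur sum of the product.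
Membership in `G(E, χ)` is needed for `x` alone; single pure tensors need not satisfy it. -/
lemma map_expDK_eq_gaussThakurSum [𝔭.IsMaximal] [Finite (A ⧸ 𝔭)] (u : A) {z : K}
    (hz : ∀ l : E.periodLattice, ∀ a ∈ 𝔭, a • E.expDK z l = 0) (x : A ⊗[F] E.periodLattice)
    (hx : TensorProduct.map hχ.algHom.toLinearMap ((E.expDK z).restrictScalars F) x ∈
      E.gaussThakurSpace χ) :
    TensorProduct.map hχ.algHom.toLinearMap ((E.expDK z).restrictScalars F) x =
      E.gaussThakurLinear χ (E.additiveCharacter (E.expDK z) hz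
        (E.mulMap u (E.toTensorAdjoin u x))) := by
  let := Ideal.Quotient.field 𝔭
  have := Fintype.ofFinite (A ⧸ 𝔭)
  have := Fintype.ofFinite (A ⧸ 𝔭)ˣ
  set W := TensorProduct.map hχ.algHom.toLinearMap ((E.expDK z).restrictScalars F) with hW
  choose s hs using fun v : (A ⧸ 𝔭)ˣ => Ideal.Quotient.mk_surjective (v : A ⧸ 𝔭)
  have hkey : ∀ y : A ⊗[F] E.periodLattice,
      -∑ v : (A ⧸ 𝔭)ˣ, (((χ v)⁻¹ : (A ⧸ 𝔭)ˣ) : A ⧸ 𝔭) • (E.phi (s v)).lTensor (A ⧸ 𝔭) (W y) =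
      E.gaussThakurLinear χ (E.additiveCharacter (E.expDK z) hz
        (E.mulMap u (E.toTensorAdjoin u y))) := by
    intro y
    induction y using TensorProduct.induction_on with
    | zero => simp
    | add y y' hy hy' =>
      simp only [map_add, AddSubgroup.coe_add, smul_add, Finset.sum_add_distrib, neg_add]
      rw [hy, hy']
    | tmul a l =>
      have h1 : E.mulMap u (E.toTensorAdjoin u (a ⊗ₜ l)) = a • l := rfl
      -- The sum attached to `a • l` is `1 ⊗ a` applied to the one attached to `l`; inside `G(E, χ)`
      -- this is multiplication by `χ(a)`, the first factor of the evaluated pure tensor.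
      have h2 : ((E.gaussThakurLinear χ (E.additiveCharacter (E.expDK z) hz (a • l)) :
          E.gaussThakurSpace χ) : (A ⧸ 𝔭) ⊗[F] E.Points) =
          χ.lift a • E.gaussThakurSum χ (E.additiveCharacter (E.expDK z) hz l) := by
        rw [map_smul, map_smul]
        exact E.gaussThakurSum_mem χ _ a
      rw [h1, h2, gaussThakurSum_eq_sum, smul_neg, Finset.smul_sum, neg_inj]
      refine Finset.sum_congr rfl fun v _ => ?_
      rw [← hs v, additiveCharacter_mk, hW, TensorProduct.map_tmul, LinearMap.lTensor_tmul,
        TensorProduct.smul_tmul', TensorProduct.smul_tmul', smul_eq_mul, smul_eq_mul, mul_comm,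
        ← hχ.algHom_apply]
      rfl
  rw [← hkey x]
  have hterm : ∀ v : (A ⧸ 𝔭)ˣ,
      (((χ v)⁻¹ : (A ⧸ 𝔭)ˣ) : A ⧸ 𝔭) • (E.phi (s v)).lTensor (A ⧸ 𝔭) (W x) = W x := fun v => by
    rw [hx (s v), χ.lift_of_mk_eq (hs v), smul_smul, Units.inv_mul, one_smul]
  simp only [hterm]
  -- The cardinality of a finite field is zero in it, so its number of units is `-1`; this cancels
  -- the sign in the definition of the sum.
  have hcard : ((Fintype.card (A ⧸ 𝔭)ˣ : ℕ) : A ⧸ 𝔭) = -1 := by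
    have h := FiniteField.cast_card_eq_zero (A ⧸ 𝔭)
    rw [← Nat.card_eq_fintype_card, Nat.card_eq_card_units_add_one, Nat.cast_add, Nat.cast_one,
      Nat.card_eq_fintype_card] at h
    exact eq_neg_of_add_eq_zero_left h
  rw [Finset.sum_const, Finset.card_univ, ← Nat.cast_smul_eq_nsmul (A ⧸ 𝔭), hcard, neg_smul,
    one_smul, neg_neg]

end Comparison

end AndersonModule

/-! ### The main theorem -/

theorem theorem5p2
    {F A K C : Type*} [Field F] [Fintype F]
    [CommRing A] [IsDedekindDomain A] [Algebra F A]
    [Field K] [Algebra F K] [Algebra A K] [IsScalarTower F A K] [IsFractionRing A K]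
    [IsCoefficientRing F A K]
    [NormedField C] [CompleteSpace C] [IsUltrametricDist C]
    [Algebra K C] [Algebra F C] [IsScalarTower F K C] [IsCInfty A K C]
    (L : IntermediateField K C) (d : ℕ) (hd : 0 < d) (E : AndersonModule F A L d)
    (𝔭 : Ideal A) (h𝔭 : 𝔭.IsMaximal)
    (u : A) (hu : u ∈ 𝔭) (hu2 : u ∉ 𝔭 ^ 2)
    (z : K) (hz : z ∈ (𝔭 : FractionalIdeal A⁰ K)⁻¹)
    (huz : ∃ c ∈ 𝔭, algebraMap A K u * z = 1 + algebraMap A K c)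
    (χ : MultiplicativeCharacter 𝔭) (hχ : χ.IsEvaluative F) :
    ∃ (δ : E.differentLattice u →ₗ[A] E.specialFunctions)
      (ψ : E.periodLattice →ₗ[A] (A ⧸ 𝔭) →ₗ[A] E.Points)
      (g : E.periodLattice →ₗ[A] E.gaussThakurSpace χ)
      (ev : E.specialFunctions →ₗ[A] E.gaussThakurSpace χ),
      (∀ μ ω, E.IsDelta u μ ω ↔ (δ μ : E.TPoints) = ω) ∧
      (∀ (l : E.periodLattice) (a : A),
        ψ l (Ideal.Quotient.mk 𝔭 a) = E.exp (E.dK (algebraMap A K a * z) l)) ∧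
      (∀ l, (g l : (A ⧸ 𝔭) ⊗[F] E.Points) = E.gaussThakurSum χ (ψ l)) ∧
      (∀ ω : E.specialFunctions, CompletedTensor.ofTensor (ev ω : (A ⧸ 𝔭) ⊗[F] E.Points) =
        E.evalAt hχ (ω : E.TPoints)) ∧
      ev ∘ₗ δ = g ∘ₗ Submodule.inclusion (E.differentLattice_le u) := by
  classical
  have hu0 : u ≠ 0 := fun h => hu2 (h ▸ Ideal.zero_mem _)
  have huF : ¬ IsIntegral F u := not_isIntegral_of_mem h𝔭.ne_top hu hu0
  have : Algebra.FiniteType F A := IsCoefficientRing.finiteType K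
  have : Finite (A ⧸ 𝔭) := finite_quotient (F := F) 𝔭
  have : Module.Finite F (A ⧸ 𝔭) := Module.Finite.of_finite
  have : Module.Finite (AndersonModule.adjoinRing F u) A := finite_adjoin_singleton F K huF
  -- The nonconstant `u` has a pole at `∞`, and the norm of `C` restricts to that place.
  have hnorm : 1 < ‖algebraMap K C (algebraMap A K u)‖ := by
    obtain ⟨W, hW, -⟩ := IsCoefficientRing.existsUnique_place (F := F) (A := A) (K := K)
    rw [← not_le, ← IsCInfty.mem_iff_norm_le_one W hW]
    exact algebraMap_notMem_place F K huF W hW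
  obtain ⟨c, hc, huc⟩ := huz
  have hue : algebraMap A K u * z = algebraMap A K (1 + c) := by rw [huc, map_add, map_one]
  have h𝔭0 : (𝔭 : FractionalIdeal A⁰ K) ≠ 0 :=
    FractionalIdeal.coeIdeal_ne_zero.2 fun h => hu0 (by rwa [h, Ideal.mem_bot] at hu)
  have hza : ∀ a ∈ 𝔭, ∃ b : A, algebraMap A K a * z = algebraMap A K b := by
    intro a ha
    obtain ⟨b, hb⟩ := (FractionalIdeal.mem_one_iff A⁰).1
      ((FractionalIdeal.mem_inv_iff h𝔭0).1 hz _ (FractionalIdeal.mem_coeIdeal_of_mem A⁰ ha))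
    exact ⟨b, by rw [hb, mul_comm]⟩
  have he : 1 + c ∉ 𝔭 := fun h => h𝔭.ne_top ((Ideal.eq_top_iff_one _).2 (by
    simpa using sub_mem h hc))
  -- With `e = 1 + c = u z`, a unit at `𝔭`, every `x ∈ 𝔭` satisfies `e * x = u * (z * x)`, and `z *
  -- x` lies in `A` because `z ∈ 𝔭⁻¹`.
  have hsep : letI := FractionRing.liftAlgebra (AndersonModule.adjoinRing F u) (FractionRing A)
      Algebra.IsSeparable (FractionRing (AndersonModule.adjoinRing F u)) (FractionRing A) := by
    refine isSeparable_fractionRing_of_mem (AndersonModule.adjoinRing F u) 𝔭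
      (u := ⟨u, Algebra.self_mem_adjoin_singleton F u⟩) hu he fun x hx => ?_
    obtain ⟨b, hb⟩ := hza x hx
    refine ⟨b, IsFractionRing.injective A K ?_⟩
    change _ = algebraMap A K (u * b)
    rw [map_mul, map_mul, ← hue, ← hb]
    ring
  -- For `a ∈ 𝔭` the product `a z` lies in `A`, so `∂(a z)` maps the period `l` to a period.
  have htors : ∀ l : E.periodLattice, ∀ a ∈ 𝔭, a • E.expDK z l = 0 := by
    intro l a ha
    obtain ⟨b, hb⟩ := hza a ha
    rw [AndersonModule.smul_expDK, hb, AndersonModule.dK_algebraMap, map_smul]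
    exact (congrArg (b • ·) l.2).trans (smul_zero b)
  have hχu : χ.lift u = 0 := χ.lift_of_mem h𝔭.ne_top hu
  have hχe : χ.lift (1 + c) = 1 := by
    rw [← hχ.algHom_apply, map_add, map_one, hχ.algHom_apply c, χ.lift_of_mem h𝔭.ne_top hc,
      add_zero]
  obtain ⟨δ, hδ⟩ := E.exists_delta hnorm
  obtain ⟨ev, hev⟩ := E.exists_evaluation hχ
  let ψ := E.additiveCharacter (E.expDK z) htors
  refine ⟨δ, ψ, E.gaussThakurLinear χ ∘ₗ ψ, ev, hδ, fun l a => E.smul_expDK a z l, fun l => rfl,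
    hev, LinearMap.ext fun μ => Subtype.ext ?_⟩
  -- The diagonality of `x` can be dropped here: what the comparison needs from it is recorded in
  -- the membership of `ev (δ μ)` in `G(E, χ)`.
  obtain ⟨x, -, hxμ, x', rfl, y, hy, hω⟩ := (hδ μ _).2 rfl
  have hw := hev (δ μ)
  rw [hω] at hw
  have hwx := E.eq_map_expDK_of_evalAt hχ hχu hue hχe hy (ev (δ μ)).2 hw
  have hmul : E.mulMap u (E.toTensorAdjoin u x') =
      Submodule.inclusion (E.differentLattice_le u) μ := Subtype.ext hxμ
  have hmem := (ev (δ μ)).2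
  rw [hwx] at hmem
  rw [LinearMap.comp_apply, hwx, E.map_expDK_eq_gaussThakurSum hχ u htors x' hmem, hmul]
  rfl
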